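/- Let $G$ be a finite simple graph with vertex set $V$, $|V|=n$. If $G$ is connected, let $D(G)=(d_G(u,v))_{u,v\in V}$ be its distance matrix, let $X=\{x_v : v\in V\}$ be indeterminates, and for $1\le i\le n$ let the $i$-th distance ideal $I_i^{\mathbb Q}(G)\subseteq\mathbb{Q}[X]$ be the ideal generated by the determinants of all $i\times i$ submatrices of $\operatorname{diag}(X)+D(G)$; it is trivial if it equals $\mathbb{Q}[X]$. Let $\Lambda_2^{\mathbb Q}$ be the family of connected graphs for which at most two of $I_1^{\mathbb Q}(G),\dots,I_n^{\mathbb Q}(G)$ are trivial. For $a\in\mathbb{Z}^k$ let $P_k^{a}$ be the graph obtained from the path $P_k$ by replacing its $i$-th vertex by a clique of size $a_i+1$ if $a_i>0$, by an independent set of size $-a_i+1$ if $a_i<0$, keeping it as a single vertex if $a_i=0$, and joining all vertices of two parts whenever the corresponding vertices of $P_k$ are adjacent. **Theorem.** $G\in\Lambda_2^{\mathbb Q}$ if and only if $G$ is connected and is (isomorphic to) one of the following: 1. a complete bipartite graph $K_{r,s}$ with $r,s\ge 1$; 2. a complete tripartite graph $K_{1,r,s}$ with $r,s\ge 1$; 3.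 a complete multipartite graph $K_{n-(p-1),1,\dots,1}$ with $p$ parts, $1\le p\le n$; 4. a connected induced subgraph of one of $P_3^{(r,-s,0)}$, $P_3^{(r,0,s)}$, $P_4^{(0,r,0,0)}$, $P_4^{(r,0,0,0)}$, $P_3^{(r,0,-s)}$ for some integers $r,s\ge 0$. -/

import Mathlib

namespace DistanceIdeals

open MvPolynomial

/-- The generalized distance matrix `diag(X) + D(G)` over `R[X]`, where the indeterminates are
indexed by the vertices of `G` and `D(G)` is the matrix of graph distances. -/
noncomputable def genDistMatrix (R : Type*) [CommRing R] {V : Type*} [DecidableEq V]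
    (G : SimpleGraph V) : Matrix V V (MvPolynomial V R) :=
  Matrix.diagonal (fun v => (X v : MvPolynomial V R)) +
    Matrix.of (fun u v => ((G.dist u v : ℕ) : MvPolynomial V R))

/-- The `i`-th distance ideal: the ideal of `R[X]` generated by the determinants of all `i × i`
submatrices of the generalized distance matrix. (Reordering the chosen rows or columns changes
a minor only by a sign.) -/
noncomputable def distIdeal (R : Type*) [CommRing R] {V : Type*} [DecidableEq V]
    (G : SimpleGraph V) (i : ℕ) : Ideal (MvPolynomial V R) :=
  Ideal.span {p | ∃ r c : Fin i ↪ V, p = ((genDistMatrix R G).submatrix r c).det}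

/-- `InLambda R k G`: the graph `G` is connected and at most `k` of its distance ideals
`I_1, …, I_n` over `R[X]` are trivial, where `n` is the number of vertices. -/
def InLambda (R : Type*) [CommRing R] (k : ℕ) {V : Type*} [Fintype V] [DecidableEq V]
    (G : SimpleGraph V) : Prop :=
  G.Connected ∧
    {i : ℕ | 1 ≤ i ∧ i ≤ Fintype.card V ∧ distIdeal R G i = ⊤}.ncard ≤ k

/-- The graph `P_k^a` obtained from the path on `k` vertices by replacing the `i`-th vertex by a
clique of size `a i + 1` if `a i > 0`, by an independent set of size `-a i + 1` if `a i < 0`,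
and keeping it as a single vertex if `a i = 0`; vertices in the parts of two adjacent
path vertices are all joined. -/
def pathBlowup {k : ℕ} (a : Fin k → ℤ) : SimpleGraph (Σ i : Fin k, Fin ((a i).natAbs + 1)) where
  Adj x y := (SimpleGraph.pathGraph k).Adj x.1 y.1 ∨ (x.1 = y.1 ∧ 0 < a x.1 ∧ x ≠ y)
  symm := ⟨by
    rintro x y (h | ⟨h, h0, hne⟩)
    · exact Or.inl h.symm
    · exact Or.inr ⟨h.symm, h ▸ h0, hne.symm⟩⟩
  loopless := ⟨by
    rintro x (h | ⟨_, _, hne⟩)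
    · exact h.ne rfl
    · exact hne rfl⟩

/-- The complete multipartite graph `K_{s 0, …, s (p-1)}` whose `i`-th part has `s i` vertices. -/
abbrev multipartite {p : ℕ} (s : Fin p → ℕ) : SimpleGraph (Σ i : Fin p, Fin (s i)) :=
  SimpleGraph.completeMultipartiteGraph (fun i => Fin (s i))

end DistanceIdeals

namespace DistanceIdeals

open MvPolynomial

/-! The distance ideals decrease (Laplace expansion), so membership in the family means that `G` is
connected and the third ideal is proper (`inLambda_iff`). By passing to the residue field of a
maximal ideal, a proper third ideal yields a field `K` of characteristic zero and values for the
diagonal of `D(G)` that make all its 3 × 3 minors vanish (`exists_rankLeTwo`); conversely, a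
rational diagonal with this property suffices (`distIdeal_three_ne_top`). The question becomes: for
which connected graphs can the distance matrix be completed on the diagonal to rank at most two?

For the listed families an explicit diagonal works, constant on the parts of the graph.

Conversely, fix a completion `M`. Distance 4 is impossible. If distance 3 occurs, take a geodesic
`a, b, c, d`. Minors tie every further vertex to the label `M b b`, and either the graph is `P_4` or
the labels of `b, c` are (1, 0) or (4/5, -1) up to reversal, which gives the two blown-up paths on
four parts (`IsDistRealization.listed_of_geodesic`).

In diameter at most two all off-diagonal entries are 1 or 2. An induced path whose centre has label
2 settles the graph (`IsRealization.listed_of_path`), and an induced four-cycle contains such a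
path. Without induced four-cycles a vertex of maximum degree is universal, since otherwise an
induced gem or five-cycle appears, and neither has a completion. Finally, the rest of the graph
either contains an induced path on three vertices or is a disjoint union of cliques, and in each
case minors through the universal vertex leave only listed graphs. -/

/-! ### The chain of distance ideals -/

lemma distIdeal_succ_le (R : Type*) [CommRing R] {V : Type*} [DecidableEq V]
    (G : SimpleGraph V) (i : ℕ) : distIdeal R G (i + 1) ≤ distIdeal R G i := by
  refine Ideal.span_le.2 ?_
  rintro _ ⟨r, c, rfl⟩
  rw [Matrix.det_succ_row_zero]
  refine Ideal.sum_mem _ fun j _ => Ideal.mul_mem_left _ _ (Ideal.subset_span ?_)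
  exact ⟨(Fin.succEmb i).trans r, (Fin.succAboveEmb j).trans c, rfl⟩

lemma distIdeal_antitone (R : Type*) [CommRing R] {V : Type*} [DecidableEq V]
    (G : SimpleGraph V) : Antitone (distIdeal R G) :=
  antitone_nat_of_succ_le (distIdeal_succ_le R G)

lemma distIdeal_eq_bot (R : Type*) [CommRing R] {V : Type*} [Fintype V] [DecidableEq V]
    (G : SimpleGraph V) {i : ℕ} (hi : Fintype.card V < i) : distIdeal R G i = ⊥ := by
  refine Ideal.span_eq_bot.2 ?_
  rintro _ ⟨r, -, -⟩
  have := Fintype.card_le_of_embedding r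
  simp only [Fintype.card_fin] at this
  omega

/-- The trivial indices form an initial segment of `1, …, n`, so more than `k` of them means that `k
+ 1` is one. The ideals beyond `n` vanish, so a trivial ideal of index `k + 1` forces `k + 1 ≤ n`.
-/
lemma inLambda_iff (R : Type*) [CommRing R] [Nontrivial R] (k : ℕ) {V : Type*} [Fintype V]
    [DecidableEq V] (G : SimpleGraph V) :
    InLambda R k G ↔ G.Connected ∧ distIdeal R G (k + 1) ≠ ⊤ := by
  refine and_congr_right fun _ => ⟨fun h htop => ?_, fun h => ?_⟩
  · have hcard : k + 1 ≤ Fintype.card V := by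
      by_contra! hlt
      exact bot_ne_top ((distIdeal_eq_bot R G hlt).symm.trans htop)
    have hsub : (Finset.Icc 1 (k + 1) : Set ℕ) ⊆
        {i : ℕ | 1 ≤ i ∧ i ≤ Fintype.card V ∧ distIdeal R G i = ⊤} := by
      intro i hi
      rw [Finset.coe_Icc, Set.mem_Icc] at hi
      exact ⟨hi.1, hi.2.trans hcard, top_le_iff.1 (htop ▸ distIdeal_antitone R G hi.2)⟩
    have hfin : {i : ℕ | 1 ≤ i ∧ i ≤ Fintype.card V ∧ distIdeal R G i = ⊤}.Finite :=
      (Set.finite_Icc 1 (Fintype.card V)).subset fun i hi => ⟨hi.1, hi.2.1⟩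
    have := Set.ncard_le_ncard hsub hfin
    rw [Set.ncard_coe_finset, Nat.card_Icc] at this
    omega
  · have hsub : {i : ℕ | 1 ≤ i ∧ i ≤ Fintype.card V ∧ distIdeal R G i = ⊤} ⊆
        (Finset.Icc 1 k : Set ℕ) := by
      rintro i ⟨h1, -, h3⟩
      rw [Finset.coe_Icc, Set.mem_Icc]
      refine ⟨h1, ?_⟩
      by_contra! hlt
      exact h (top_le_iff.1 (h3 ▸ distIdeal_antitone R G hlt))
    have := Set.ncard_le_ncard hsub (Finset.finite_toSet _)
    rwa [Set.ncard_coe_finset, Nat.card_Icc, Nat.add_sub_cancel] at this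

/-! ### Properness of the third ideal as a rank-two completion -/

/-- All `3 × 3` minors of `M` vanish. -/
def RankLeTwo {V K : Type*} [CommRing K] (M : V → V → K) : Prop :=
  ∀ p q r x y z : V,
    M p x * (M q y * M r z - M q z * M r y) - M p y * (M q x * M r z - M q z * M r x) +
      M p z * (M q x * M r y - M q y * M r x) = 0

lemma rankLeTwo_of_eq_add {V K : Type*} [CommRing K] {M : V → V → K} (a b c d : V → K)
    (h : ∀ u v, M u v = a u * b v + c u * d v) : RankLeTwo M := by
  intro p q r x y z
  simp only [h]
  ring

/-- Evaluation at the diagonal of `M` kills every generator, so the ideal lies in the kernel of a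
ring homomorphism to `ℚ`. -/
lemma distIdeal_three_ne_top {V : Type*} [DecidableEq V] (G : SimpleGraph V) {M : V → V → ℚ}
    (hM : RankLeTwo M) (h : ∀ u v, u ≠ v → (G.dist u v : ℚ) = M u v) :
    distIdeal ℚ G 3 ≠ ⊤ := by
  set φ : MvPolynomial V ℚ →+* ℚ := (aeval fun v => M v v : MvPolynomial V ℚ →ₐ[ℚ] ℚ).toRingHom
  have hle : distIdeal ℚ G 3 ≤ RingHom.ker φ := by
    refine Ideal.span_le.2 ?_
    rintro _ ⟨r, c, rfl⟩
    have hent : ∀ u v, φ (genDistMatrix ℚ G u v) = M u v := by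
      intro u v
      by_cases huv : u = v
      · subst huv
        simp [genDistMatrix, φ]
      · simp [genDistMatrix, φ, huv, ← h u v huv]
    rw [SetLike.mem_coe, RingHom.mem_ker, RingHom.map_det, Matrix.det_fin_three]
    simp only [RingHom.mapMatrix_apply, Matrix.map_apply, Matrix.submatrix_apply, hent]
    linear_combination hM (r 0) (r 1) (r 2) (c 0) (c 1) (c 2)
  exact fun htop => RingHom.ker_ne_top φ (top_le_iff.1 (htop ▸ hle))

/-- Here `K` is the residue field of a maximal ideal above the third distance ideal, and `M` is the
image of the generalized distance matrix. The diagonal values need not be rational. -/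
lemma exists_rankLeTwo.{u} {V : Type u} [DecidableEq V] (G : SimpleGraph V)
    (h : distIdeal ℚ G 3 ≠ ⊤) :
    ∃ (K : Type u) (_ : Field K) (_ : CharZero K) (M : V → V → K), RankLeTwo M ∧
      (∀ u v, M u v = M v u) ∧ ∀ u v, u ≠ v → M u v = (G.dist u v : K) := by
  obtain ⟨m, hm, hle⟩ := Ideal.exists_le_maximal _ h
  let K := MvPolynomial V ℚ ⧸ m
  let _ : Field K := Ideal.Quotient.field m
  refine ⟨K, inferInstance, algebraRat.charZero K,
    fun u v => Ideal.Quotient.mk m (genDistMatrix ℚ G u v), ?_, ?_, ?_⟩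
  · intro p q r x y z
    -- The generators only use distinct rows and distinct columns; a repetition makes the
    -- determinant zero.
    have hdet : ((genDistMatrix ℚ G).submatrix ![p, q, r] ![x, y, z]).det ∈ m := by
      by_cases hr : Function.Injective ![p, q, r]
      · by_cases hc : Function.Injective ![x, y, z]
        · exact hle (Ideal.subset_span ⟨⟨_, hr⟩, ⟨_, hc⟩, rfl⟩)
        · simp only [Function.Injective, not_forall] at hc
          obtain ⟨i, j, hij, hne⟩ := hc
          rw [Matrix.det_zero_of_column_eq hne]
          · exact m.zero_mem
          · intro k
            simp only [Matrix.submatrix_apply, hij]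
      · simp only [Function.Injective, not_forall] at hr
        obtain ⟨i, j, hij, hne⟩ := hr
        rw [Matrix.det_zero_of_row_eq hne]
        · exact m.zero_mem
        · ext k : 1
          simp only [Matrix.submatrix_apply, hij]
    rw [← Ideal.Quotient.eq_zero_iff_mem, RingHom.map_det, Matrix.det_fin_three] at hdet
    simp only [RingHom.mapMatrix_apply, Matrix.map_apply, Matrix.submatrix_apply,
      Matrix.cons_val] at hdet
    linear_combination hdet
  · intro u v
    by_cases huv : u = v
    · rw [huv]
    · simp [genDistMatrix, huv, Ne.symm huv, G.dist_comm (u := u)]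
  · intro u v huv
    simp [genDistMatrix, huv]

/-! ### Distances in blow-ups of paths and in multipartite graphs -/

variable {V : Type*} {G : SimpleGraph V}

lemma two_le_dist {u v : V} (hG : G.Connected) (hne : u ≠ v) (h : ¬ G.Adj u v) :
    2 ≤ G.dist u v := by
  have h0 := hG.pos_dist_of_ne hne
  have h1 : G.dist u v ≠ 1 := fun h1 => h (SimpleGraph.dist_eq_one_iff_adj.1 h1)
  omega

lemma dist_eq_two {u v w : V} (hG : G.Connected) (hne : u ≠ v) (h : ¬ G.Adj u v)
    (hu : G.Adj u w) (hv : G.Adj w v) : G.dist u v = 2 := by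
  refine le_antisymm ?_ (two_le_dist hG hne h)
  have := hG.dist_triangle (u := u) (v := w) (w := v)
  rwa [SimpleGraph.dist_eq_one_iff_adj.2 hu, SimpleGraph.dist_eq_one_iff_adj.2 hv] at this

lemma exists_adj {u v : V} (hG : G.Connected) (hne : u ≠ v) : ∃ w, G.Adj u w :=
  haveI : Nontrivial V := ⟨u, v, hne⟩
  hG.preconnected.exists_adj_of_nontrivial u

/-- Distances in a connected complete multipartite graph. -/
lemma dist_of_adj_iff_ne {ι : Type*} [DecidableEq ι] (hG : G.Connected) (f : V → ι)
    (hf : ∀ u v, G.Adj u v ↔ f u ≠ f v) {u v : V} (hne : u ≠ v) :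
    G.dist u v = if f u = f v then 2 else 1 := by
  split_ifs with h
  · obtain ⟨w, hw⟩ := exists_adj hG hne
    refine dist_eq_two hG hne (fun hadj => (hf u v).1 hadj h) hw ?_
    rw [hf] at hw ⊢
    exact h ▸ hw.symm
  · exact SimpleGraph.dist_eq_one_iff_adj.2 ((hf u v).2 h)

/-- A labelling of the vertices of a graph that presents it as an induced subgraph of
`pathBlowup a`, up to the sizes of the parts that are not single vertices. -/
structure IsPathLabelling {k : ℕ} (G : SimpleGraph V) (a : Fin k → ℤ) (f : V → Fin k) : Prop where
  adj_iff : ∀ u v, u ≠ v → (G.Adj u v ↔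
    ((f u : ℕ) + 1 = f v ∨ (f v : ℕ) + 1 = f u) ∨ (f u = f v ∧ 0 < a (f u)))
  unique : ∀ u v, f u = f v → a (f u) = 0 → u = v

lemma IsPathLabelling.of_isIndContained {k : ℕ} {a : Fin k → ℤ}
    (h : G.IsIndContained (pathBlowup a)) : ∃ f, IsPathLabelling G a f := by
  obtain ⟨φ⟩ := h
  refine ⟨fun v => (φ v).1, fun u v hne => ?_, fun u v huv ha => ?_⟩
  · have hne' : φ u ≠ φ v := fun h => hne (φ.injective h)
    rw [← φ.map_adj_iff]
    simp only [pathBlowup, SimpleGraph.pathGraph_adj]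
    exact or_congr_right (and_congr_right fun _ => and_iff_left hne')
  · refine φ.injective (Sigma.ext huv ?_)
    have : Subsingleton (Fin ((a (φ u).1).natAbs + 1)) := by
      rw [ha]
      exact inferInstanceAs (Subsingleton (Fin 1))
    have key : ∀ x y : Σ i, Fin ((a i).natAbs + 1), x.1 = y.1 →
        Subsingleton (Fin ((a x.1).natAbs + 1)) → HEq x.2 y.2 := by
      rintro ⟨i, x⟩ ⟨j, y⟩ hij hs
      obtain rfl : i = j := hij
      exact heq_of_eq (hs.elim x y)
    exact key _ _ huv this

/-- A discrete intermediate value theorem: a label that rises by at most one per edge skips no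
level. -/
lemma exists_map_eq_of_walk (f : V → ℕ) (hf : ∀ u v, G.Adj u v → f v ≤ f u + 1) {u v : V}
    (p : G.Walk u v) {m : ℕ} (hu : f u ≤ m) (hv : m ≤ f v) : ∃ w, f w = m := by
  induction p with
  | nil => exact ⟨_, le_antisymm hu hv⟩
  | @cons u w v h p ih =>
    by_cases hm : f u = m
    · exact ⟨u, hm⟩
    · have := hf _ _ h
      exact ih (by omega) hv

namespace IsPathLabelling

variable {k : ℕ} {a : Fin k → ℤ} {f : V → Fin k}

lemma le_add_one_of_adj (hf : IsPathLabelling G a f) {u v : V} (h : G.Adj u v) :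
    (f v : ℕ) ≤ f u + 1 := by
  rcases (hf.adj_iff u v h.ne).1 h with (h | h) | ⟨h, -⟩
  · omega
  · omega
  · rw [h]
    omega

lemma le_add_dist (hf : IsPathLabelling G a f) (hG : G.Connected) (u v : V) :
    (f v : ℕ) ≤ f u + G.dist u v := by
  obtain ⟨p, hp⟩ := hG.exists_walk_length_eq_dist u v
  rw [← hp]
  clear hp
  induction p with
  | nil => simp
  | cons h p ih =>
    have := hf.le_add_one_of_adj h
    rw [SimpleGraph.Walk.length_cons]
    omega

/-- Labels rise by at most one per edge, which bounds the distance from below. Connectedness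
supplies a vertex on every intermediate level, and consecutive levels are completely joined, which
gives the upper bound. Thus distances in a connected induced subgraph agree with those of the
blow-up. -/
lemma dist_of_add_eq (hf : IsPathLabelling G a f) (hG : G.Connected) (n : ℕ) {u v : V}
    (h : (f u : ℕ) + (n + 1) = f v) : G.dist u v = n + 1 := by
  induction n generalizing u with
  | zero =>
    refine SimpleGraph.dist_eq_one_iff_adj.2 ((hf.adj_iff u v ?_).2 (Or.inl (Or.inl h)))
    rintro rfl
    omega
  | succ n ih =>
    obtain ⟨p⟩ := hG.preconnected u v
    obtain ⟨w, hw⟩ := exists_map_eq_of_walk (fun v => (f v : ℕ))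
      (fun _ _ h => hf.le_add_one_of_adj h) p (m := f u + 1) (Nat.le_succ _) (by omega)
    have huw : G.dist u w = 1 := by
      refine SimpleGraph.dist_eq_one_iff_adj.2 ((hf.adj_iff u w ?_).2 (Or.inl (Or.inl hw.symm)))
      rintro rfl
      omega
    have hwv := ih (u := w) (by omega)
    have h1 := hG.dist_triangle (u := u) (v := w) (w := v)
    have h2 := hf.le_add_dist hG u v
    omega

/-- In a part that is not a clique, a neighbour of `u` lies in an adjacent part and hence is also a
neighbour of `v`. -/
lemma dist_of_eq (hf : IsPathLabelling G a f) (hG : G.Connected) {u v : V} (hne : u ≠ v)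
    (h : f u = f v) : G.dist u v = if 0 < a (f u) then 1 else 2 := by
  split_ifs with ha
  · exact SimpleGraph.dist_eq_one_iff_adj.2 ((hf.adj_iff u v hne).2 (Or.inr ⟨h, ha⟩))
  · have hnadj : ∀ w, f w = f u → ¬ G.Adj u w := by
      intro w hw hadj
      rcases (hf.adj_iff u w hadj.ne).1 hadj with (h | h) | ⟨-, h⟩
      · omega
      · omega
      · exact ha h
    obtain ⟨w, hw⟩ := exists_adj hG hne
    refine dist_eq_two hG hne (hnadj v h.symm) hw ?_
    have hw' := (hf.adj_iff u w hw.ne).1 hw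
    have hwv : w ≠ v := by
      rintro rfl
      exact hnadj w h.symm hw
    rw [hf.adj_iff w v hwv, ← h]
    rcases hw' with (h' | h') | ⟨-, h'⟩
    · exact Or.inl (Or.inr h')
    · exact Or.inl (Or.inl h')
    · exact (ha h').elim

/-- If the matrix `Q` has rank at most two and agrees with the distances between the parts, then
the third distance ideal is nontrivial. -/
lemma distIdeal_ne_top [DecidableEq V] (hf : IsPathLabelling G a f) (hG : G.Connected)
    {Q : Fin k → Fin k → ℚ} (hQ : RankLeTwo Q) (hsymm : ∀ i j, Q i j = Q j i)
    (hpos : ∀ i, 0 < a i → Q i i = 1) (hneg : ∀ i, a i < 0 → Q i i = 2)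
    (hlt : ∀ i j, i < j → Q i j = (j : ℚ) - (i : ℚ)) : distIdeal ℚ G 3 ≠ ⊤ := by
  refine distIdeal_three_ne_top G (M := fun u v => Q (f u) (f v))
    (fun p q r x y z => hQ _ _ _ _ _ _) fun u v hne => ?_
  have aux : ∀ u v, f u < f v → (G.dist u v : ℚ) = Q (f u) (f v) := by
    intro u v h
    obtain ⟨n, hn⟩ := Nat.exists_eq_add_of_lt (Fin.lt_def.1 h)
    rw [hf.dist_of_add_eq hG n (by omega), hlt _ _ h, hn]
    push_cast
    ring
  rcases lt_trichotomy (f u) (f v) with h | h | h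
  · exact aux u v h
  · rw [hf.dist_of_eq hG hne h, ← h]
    rcases lt_trichotomy (a (f u)) 0 with h0 | h0 | h0
    · simp [hneg _ h0, h0.le]
    · exact (hne (hf.unique u v h h0)).elim
    · simp [hpos _ h0, h0]
  · rw [G.dist_comm, hsymm]
    exact aux v u h

end IsPathLabelling

/-- A complete multipartite graph for which the rank-two condition is witnessed by `Q`. -/
lemma distIdeal_ne_top_of_adj_iff_ne {ι κ : Type*} [DecidableEq ι] [DecidableEq V]
    (hG : G.Connected) (f : V → ι) (hf : ∀ u v, G.Adj u v ↔ f u ≠ f v) (g : ι → κ)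
    {Q : κ → κ → ℚ} (hQ : RankLeTwo Q) (hne : ∀ i j, i ≠ j → Q (g i) (g j) = 1)
    (heq : ∀ u v, u ≠ v → f u = f v → Q (g (f u)) (g (f u)) = 2) : distIdeal ℚ G 3 ≠ ⊤ := by
  refine distIdeal_three_ne_top G (M := fun u v => Q (g (f u)) (g (f v)))
    (fun p q r x y z => hQ _ _ _ _ _ _) fun u v huv => ?_
  rw [dist_of_adj_iff_ne hG f hf huv]
  split_ifs with h
  · rw [← h, heq u v huv h]
    norm_num
  · rw [hne _ _ h]
    norm_num

/-! ### Explicit diagonals for the listed families -/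

section Families

variable [DecidableEq V] (hG : G.Connected)

include hG

lemma distIdeal_ne_top_bipartite {n m : ℕ}
    (φ : G ≃g completeBipartiteGraph (Fin n) (Fin m)) : distIdeal ℚ G 3 ≠ ⊤ := by
  refine distIdeal_ne_top_of_adj_iff_ne hG (fun v => (φ v).isLeft) (fun u v => ?_) id
    (Q := fun i j => if i = j then 2 else 1)
    (rankLeTwo_of_eq_add (fun _ => 1) (fun _ => 3 / 2) (fun i => if i then 1 else -1)
      (fun i => if i then 1 / 2 else -1 / 2) ?_)
    (fun i j h => by simp [h]) (fun _ _ _ _ => by simp)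
  · rw [← φ.map_adj_iff]
    rcases φ u with x | x <;> rcases φ v with y | y <;> simp
  · rintro (_ | _) (_ | _) <;> norm_num

/-- Large parts need label 2; the label of the single vertex is free, and the determinant `3x - 2`
makes it 2/3. -/
lemma distIdeal_ne_top_tripartite {n m : ℕ} (φ : G ≃g multipartite ![1, n, m]) :
    distIdeal ℚ G 3 ≠ ⊤ := by
  refine distIdeal_ne_top_of_adj_iff_ne hG (fun v => (φ v).1) (fun u v => ?_) id
    (Q := !![2/3, 1, 1; 1, 2, 1; 1, 1, 2])
    (rankLeTwo_of_eq_add ![2/3, 1, 1] ![1, 3/2, 3/2] ![0, 1/2, -1/2] ![0, 1, -1] ?_) ?_ ?_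
  · rw [← φ.map_adj_iff]
    simp
  · intro i j
    fin_cases i <;> fin_cases j <;> norm_num
  · intro i j h
    fin_cases i <;> fin_cases j <;> simp_all
  · intro u v hne h
    have key : ∀ x y : Σ i : Fin 3, Fin (![1, n, m] i), x ≠ y → x.1 = y.1 → x.1 ≠ 0 := by
      rintro ⟨i, x⟩ ⟨j, y⟩ hxy rfl h0
      obtain rfl : i = 0 := h0
      have : Subsingleton (Fin (![1, n, m] 0)) := inferInstanceAs (Subsingleton (Fin 1))
      exact hxy (by rw [this.elim x y])
    have h0 := key _ _ (fun h => hne (φ.injective h)) h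
    clear key h
    generalize (φ u).1 = i at h0 ⊢
    fin_cases i <;> simp_all

lemma distIdeal_ne_top_split {N p : ℕ}
    (φ : G ≃g multipartite (fun i : Fin p => if (i : ℕ) = 0 then N else 1)) :
    distIdeal ℚ G 3 ≠ ⊤ := by
  refine distIdeal_ne_top_of_adj_iff_ne hG (fun v => (φ v).1) (fun u v => ?_)
    (fun i => decide ((i : ℕ) = 0)) (Q := fun i j => if i && j then 2 else 1)
    (rankLeTwo_of_eq_add (fun _ => 1) (fun _ => 1) (fun i => if i then 1 else 0)
      (fun i => if i then 1 else 0) ?_) ?_ ?_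
  · rw [← φ.map_adj_iff]
    simp
  · rintro (_ | _) (_ | _) <;> norm_num
  · intro i j h
    have : ¬ ((i : ℕ) = 0 ∧ (j : ℕ) = 0) := fun h' => h (Fin.ext (h'.1.trans h'.2.symm))
    simp [this]
  · intro u v hne h
    have key : ∀ x y : Σ i : Fin p, Fin (if (i : ℕ) = 0 then N else 1), x ≠ y → x.1 = y.1 →
        (x.1 : ℕ) = 0 := by
      rintro ⟨i, x⟩ ⟨j, y⟩ hxy rfl
      by_contra h0
      have : Subsingleton (Fin (if (i : ℕ) = 0 then N else 1)) := by
        rw [if_neg h0]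
        infer_instance
      exact hxy (by rw [this.elim x y])
    have h0 := key _ _ (fun h => hne (φ.injective h)) h
    simp [h0]

/-- Cliques carry label 1 and independent parts label 2, so only single vertices have free labels.
In the three-part families the vanishing determinant determines this one label: 5 here, 2/3 between
two cliques, 1/2 between a clique and an independent set. -/
lemma distIdeal_ne_top_clique_indep_single {n m : ℕ}
    (h : G.IsIndContained (pathBlowup ![(n : ℤ), -(m : ℤ), 0])) : distIdeal ℚ G 3 ≠ ⊤ := by
  obtain ⟨f, hf⟩ := IsPathLabelling.of_isIndContained h
  refine hf.distIdeal_ne_top hG (Q := !![1, 1, 2; 1, 2, 1; 2, 1, 5])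
    (rankLeTwo_of_eq_add ![1, 1, 2] ![1, 1, 2] ![0, 1, -1] ![0, 1, -1] ?_) ?_ ?_ ?_ ?_
  · intro i j
    fin_cases i <;> fin_cases j <;> norm_num
  · intro i j
    fin_cases i <;> fin_cases j <;> norm_num
  · intro i
    fin_cases i <;> simp
  · intro i
    fin_cases i <;> simp
  · intro i j
    fin_cases i <;> fin_cases j <;> norm_num

lemma distIdeal_ne_top_clique_single_clique {n m : ℕ}
    (h : G.IsIndContained (pathBlowup ![(n : ℤ), 0, (m : ℤ)])) : distIdeal ℚ G 3 ≠ ⊤ := by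
  obtain ⟨f, hf⟩ := IsPathLabelling.of_isIndContained h
  refine hf.distIdeal_ne_top hG (Q := !![1, 1, 2; 1, 2/3, 1; 2, 1, 1])
    (rankLeTwo_of_eq_add ![1, 1, 2] ![1, 1, 2] ![0, -1/3, -1] ![0, 1, 3] ?_) ?_ ?_ ?_ ?_
  · intro i j
    fin_cases i <;> fin_cases j <;> norm_num
  · intro i j
    fin_cases i <;> fin_cases j <;> norm_num
  · intro i
    fin_cases i <;> simp
  · intro i
    fin_cases i <;> simp
  · intro i j
    fin_cases i <;> fin_cases j <;> norm_num

lemma distIdeal_ne_top_clique_single_indep {n m : ℕ}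
    (h : G.IsIndContained (pathBlowup ![(n : ℤ), 0, -(m : ℤ)])) : distIdeal ℚ G 3 ≠ ⊤ := by
  obtain ⟨f, hf⟩ := IsPathLabelling.of_isIndContained h
  refine hf.distIdeal_ne_top hG (Q := !![1, 1, 2; 1, 1/2, 1; 2, 1, 2])
    (rankLeTwo_of_eq_add ![1, 1, 2] ![1, 1, 2] ![0, -1/2, -1] ![0, 1, 2] ?_) ?_ ?_ ?_ ?_
  · intro i j
    fin_cases i <;> fin_cases j <;> norm_num
  · intro i j
    fin_cases i <;> fin_cases j <;> norm_num
  · intro i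
    fin_cases i <;> simp
  · intro i
    fin_cases i <;> simp
  · intro i j
    fin_cases i <;> fin_cases j <;> norm_num

lemma distIdeal_ne_top_path_second {n : ℕ}
    (h : G.IsIndContained (pathBlowup ![0, (n : ℤ), 0, 0])) : distIdeal ℚ G 3 ≠ ⊤ := by
  obtain ⟨f, hf⟩ := IsPathLabelling.of_isIndContained h
  -- Label 1 on the second part forces the other three diagonal entries.
  refine hf.distIdeal_ne_top hG (Q := !![0, 1, 2, 3; 1, 1, 1, 2; 2, 1, 0, 1; 3, 2, 1, 3])
    (rankLeTwo_of_eq_add ![1, 1, 1, 2] ![1, 1, 1, 2] ![1, 0, -1, -1] ![-1, 0, 1, 1] ?_)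
    ?_ ?_ ?_ ?_
  · intro i j
    fin_cases i <;> fin_cases j <;> norm_num
  · intro i j
    fin_cases i <;> fin_cases j <;> norm_num
  · intro i
    fin_cases i <;> simp
  · intro i
    fin_cases i <;> simp
  · intro i j
    fin_cases i <;> fin_cases j <;> norm_num

lemma distIdeal_ne_top_path_first {n : ℕ}
    (h : G.IsIndContained (pathBlowup ![(n : ℤ), 0, 0, 0])) : distIdeal ℚ G 3 ≠ ⊤ := by
  obtain ⟨f, hf⟩ := IsPathLabelling.of_isIndContained h
  -- Label 1 on the first part forces 4/5, -1 and 4 on the others.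
  refine hf.distIdeal_ne_top hG (Q := !![1, 1, 2, 3; 1, 4/5, 1, 2; 2, 1, -1, 1; 3, 2, 1, 4])
    (rankLeTwo_of_eq_add ![1, 1, 2, 3] ![1, 1, 2, 3] ![0, 1, 5, 5] ![0, -1/5, -1, -1] ?_)
    ?_ ?_ ?_ ?_
  · intro i j
    fin_cases i <;> fin_cases j <;> norm_num
  · intro i j
    fin_cases i <;> fin_cases j <;> norm_num
  · intro i
    fin_cases i <;> simp
  · intro i
    fin_cases i <;> simp
  · intro i j
    fin_cases i <;> fin_cases j <;> norm_num

end Families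

/-! ### Recognizing listed graphs from labellings -/

lemma IsPathLabelling.isIndContained [Fintype V] {k : ℕ} {a : Fin k → ℤ} {f : V → Fin k}
    (hf : IsPathLabelling G a f) (ha : ∀ i, a i ≠ 0 → Fintype.card V ≤ (a i).natAbs) :
    G.IsIndContained (pathBlowup a) := by
  classical
  have hcard : ∀ i, Fintype.card {v // f v = i} ≤ Fintype.card (Fin ((a i).natAbs + 1)) := by
    intro i
    rw [Fintype.card_fin]
    by_cases h : a i = 0
    · have : Subsingleton {v // f v = i} := by
        refine ⟨fun u v => Subtype.ext (hf.unique _ _ (u.2.trans v.2.symm) ?_)⟩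
        rw [u.2, h]
      exact Fintype.card_le_one_iff_subsingleton.2 this |>.trans (by omega)
    · exact (Fintype.card_subtype_le _).trans ((ha i h).trans (Nat.le_succ _))
  let e := fun i => (Function.Embedding.nonempty_of_card_le (hcard i)).some
  have hinj : Function.Injective
      (fun v => (⟨f v, e (f v) ⟨v, rfl⟩⟩ : Σ i : Fin k, Fin ((a i).natAbs + 1))) := by
    -- The index `i` is kept variable so that elements of different fibres can be compared without
    -- casts.
    have key : ∀ u v i (hu : f u = i) (hv : f v = i), e i ⟨u, hu⟩ = e i ⟨v, hv⟩ → u = v :=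
      fun u v i hu hv h => congrArg Subtype.val ((e i).injective h)
    intro u v huv
    have h1 : f u = f v := congrArg Sigma.fst huv
    refine key u v (f v) h1 rfl ?_
    have : ∀ i (hu : f u = i), (⟨f u, e (f u) ⟨u, rfl⟩⟩ : Σ i : Fin k, Fin ((a i).natAbs + 1)) =
        ⟨i, e i ⟨u, hu⟩⟩ := by
      rintro _ rfl
      rfl
    have h2 := (this _ h1).symm.trans huv
    exact eq_of_heq (Sigma.mk.inj h2).2
  refine ⟨⟨⟨_, hinj⟩, ?_⟩⟩
  intro u v
  by_cases huv : u = v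
  · subst huv
    simp
  · rw [hf.adj_iff u v huv]
    simp only [pathBlowup, SimpleGraph.pathGraph_adj, Function.Embedding.coeFn_mk]
    exact or_congr_right (and_congr_right fun _ => and_iff_left (hinj.ne huv))

lemma nonempty_iso_bipartite [Fintype V] (s : Set V) (hs : ∃ v, v ∈ s) (hs' : ∃ v, v ∉ s)
    (h : ∀ u v, G.Adj u v ↔ (u ∈ s ↔ v ∉ s)) :
    ∃ n m : ℕ, 1 ≤ n ∧ 1 ≤ m ∧ Nonempty (G ≃g completeBipartiteGraph (Fin n) (Fin m)) := by
  classical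
  refine ⟨Fintype.card {v // v ∈ s}, Fintype.card {v // v ∉ s}, ?_, ?_, ?_⟩
  · exact Fintype.card_pos_iff.2 ⟨⟨_, hs.choose_spec⟩⟩
  · exact Fintype.card_pos_iff.2 ⟨⟨_, hs'.choose_spec⟩⟩
  · refine ⟨SimpleGraph.Iso.symm ⟨((Equiv.sumCongr (Fintype.equivFin {v // v ∈ s})
      (Fintype.equivFin {v // v ∉ s})).symm.trans (Equiv.sumCompl fun v => v ∈ s)), ?_⟩⟩
    intro x y
    rw [h]
    have hmem : ∀ x, ((Fintype.equivFin {v // v ∉ s}).symm x : V) ∉ s := fun x => ((Fintype.equivFin {v // v ∉ s}).symm x).2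
    rcases x with x | x <;> rcases y with y | y <;> simp [hmem]

lemma nonempty_iso_multipartite [Fintype V] {p : ℕ} (s : Fin p → ℕ) (f : V → Fin p)
    (hf : ∀ u v, G.Adj u v ↔ f u ≠ f v) (hs : ∀ i, Nat.card {v // f v = i} = s i) :
    Nonempty (G ≃g multipartite s) := by
  classical
  have e : ∀ i, Nonempty ({v // f v = i} ≃ Fin (s i)) := fun i => by
    rw [← hs i]
    exact ⟨Finite.equivFin _⟩
  refine ⟨⟨(Equiv.sigmaFiberEquiv f).symm.trans
    (Equiv.sigmaCongrRight fun i => (e i).some), ?_⟩⟩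
  intro u v
  rw [hf]
  simp [Equiv.sigmaFiberEquiv]

lemma nonempty_iso_tripartite [Fintype V] (f : V → Fin 3)
    (hf : ∀ u v, G.Adj u v ↔ f u ≠ f v) (h0 : ∃! v, f v = 0) (h1 : ∃ v, f v = 1)
    (h2 : ∃ v, f v = 2) :
    ∃ n m : ℕ, 1 ≤ n ∧ 1 ≤ m ∧ Nonempty (G ≃g multipartite ![1, n, m]) := by
  refine ⟨Nat.card {v // f v = 1}, Nat.card {v // f v = 2}, ?_, ?_,
    nonempty_iso_multipartite _ f hf ?_⟩
  · exact Nat.card_pos_iff.2 ⟨⟨_, h1.choose_spec⟩, inferInstance⟩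
  · exact Nat.card_pos_iff.2 ⟨⟨_, h2.choose_spec⟩, inferInstance⟩
  · intro i
    fin_cases i
    · obtain ⟨v, hv, huniq⟩ := h0
      exact Nat.card_eq_one_iff_exists.2 ⟨⟨v, hv⟩, fun w => Subtype.ext (huniq w w.2)⟩
    · rfl
    · rfl

/-- A graph that is the join of a clique and a nonempty independent set `s`. -/
lemma nonempty_iso_split [Fintype V] (s : Set V) (hs : ∃ v, v ∈ s)
    (h : ∀ u v, u ≠ v → (G.Adj u v ↔ ¬ (u ∈ s ∧ v ∈ s))) :
    ∃ p : ℕ, 1 ≤ p ∧ p ≤ Fintype.card V ∧ Nonempty (G ≃g multipartite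
      (fun i : Fin p => if (i : ℕ) = 0 then Fintype.card V - (p - 1) else 1)) := by
  classical
  have hpos : 0 < Fintype.card {v // v ∈ s} := Fintype.card_pos_iff.2 ⟨⟨_, hs.choose_spec⟩⟩
  have hsum : Fintype.card {v // v ∈ s} + Fintype.card {v // v ∉ s} = Fintype.card V := by
    rw [← Fintype.card_sum]
    exact Fintype.card_congr (Equiv.sumCompl fun v => v ∈ s)
  set e := Fintype.equivFin {v // v ∉ s}
  set f : V → Fin (Fintype.card {v // v ∉ s} + 1) :=
    fun v => if hv : v ∈ s then 0 else (e ⟨v, hv⟩).succ with hfdef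
  have hf0 : ∀ v, v ∈ s → f v = 0 := fun v hv => by simp [hfdef, hv]
  have hf1 : ∀ v (hv : v ∉ s), f v = (e ⟨v, hv⟩).succ := fun v hv => by simp [hfdef, hv]
  refine ⟨Fintype.card {v // v ∉ s} + 1, by omega, by omega,
    nonempty_iso_multipartite _ f ?_ ?_⟩
  · intro u v
    by_cases huv : u = v
    · subst huv
      simp
    rw [h u v huv]
    by_cases hu : u ∈ s <;> by_cases hv : v ∈ s
    · simp [hf0 _ hu, hf0 _ hv, hu, hv]
    · simp [hf0 _ hu, hf1 _ hv, hv, (Fin.succ_ne_zero _).symm]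
    · simp [hf1 _ hu, hf0 _ hv, hu]
    · simp [hf1 _ hu, hf1 _ hv, hu, huv]
  · intro i
    refine Fin.cases ?_ (fun j => ?_) i
    · have hiff : ∀ v, f v = 0 ↔ v ∈ s := fun v =>
        ⟨fun hv => by_contra fun hvs => by simp [hf1 v hvs] at hv, hf0 v⟩
      rw [Nat.card_congr (Equiv.subtypeEquivRight hiff), Nat.card_eq_fintype_card]
      simp only [Fin.val_zero, if_true]
      omega
    · simp only [Fin.val_succ, Nat.add_eq_zero_iff, one_ne_zero, and_false, if_false]
      refine Nat.card_eq_one_iff_exists.2 ⟨⟨e.symm j, ?_⟩, ?_⟩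
      · rw [hf1 _ (e.symm j).2]
        simp
      · rintro ⟨v, hv⟩
        have hvs : v ∉ s := fun hvs => by simp [hf0 v hvs, eq_comm] at hv
        rw [hf1 v hvs, Fin.succ_inj] at hv
        refine Subtype.ext ?_
        simp [← hv]

/-- The graphs of the classification, apart from connectedness. -/
def Listed [Fintype V] (G : SimpleGraph V) : Prop :=
  (∃ n m : ℕ, 1 ≤ n ∧ 1 ≤ m ∧ Nonempty (G ≃g completeBipartiteGraph (Fin n) (Fin m))) ∨
  (∃ n m : ℕ, 1 ≤ n ∧ 1 ≤ m ∧ Nonempty (G ≃g multipartite ![1, n, m])) ∨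
  (∃ p : ℕ, 1 ≤ p ∧ p ≤ Fintype.card V ∧ Nonempty (G ≃g multipartite
    (fun i : Fin p => if (i : ℕ) = 0 then Fintype.card V - (p - 1) else 1))) ∨
  (∃ n m : ℕ, G.IsIndContained (pathBlowup ![(n : ℤ), -(m : ℤ), 0])) ∨
  (∃ n₁ n₂ : ℕ, G.IsIndContained (pathBlowup ![(n₁ : ℤ), 0, (n₂ : ℤ)])) ∨
  (∃ n : ℕ, G.IsIndContained (pathBlowup ![0, (n : ℤ), 0, 0])) ∨
  (∃ n : ℕ, G.IsIndContained (pathBlowup ![(n : ℤ), 0, 0, 0])) ∨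
  (∃ n m : ℕ, G.IsIndContained (pathBlowup ![(n : ℤ), 0, -(m : ℤ)]))

namespace Listed

variable [Fintype V]

lemma of_bipartite (s : Set V) (hs : ∃ v, v ∈ s) (hs' : ∃ v, v ∉ s)
    (h : ∀ u v, u ≠ v → (G.Adj u v ↔ (u ∈ s ↔ v ∉ s))) : Listed G := by
  refine Or.inl (nonempty_iso_bipartite s hs hs' fun u v => ?_)
  by_cases huv : u = v
  · subst huv
    simp
  · exact h u v huv

lemma of_tripartite (f : V → Fin 3) (hf : ∀ u v, u ≠ v → (G.Adj u v ↔ f u ≠ f v))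
    (h0 : ∃! v, f v = 0) (h1 : ∃ v, f v = 1) (h2 : ∃ v, f v = 2) : Listed G := by
  refine Or.inr (Or.inl (nonempty_iso_tripartite f (fun u v => ?_) h0 h1 h2))
  by_cases huv : u = v
  · subst huv
    simp
  · exact hf u v huv

lemma of_split (s : Set V) (hs : ∃ v, v ∈ s)
    (h : ∀ u v, u ≠ v → (G.Adj u v ↔ ¬ (u ∈ s ∧ v ∈ s))) : Listed G :=
  Or.inr (Or.inr (Or.inl (nonempty_iso_split s hs h)))

/-- Both size parameters are taken to be `|V|`, large enough for any fibre; `|V| > 0` ensures that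
the clique part has positive sign. -/
lemma of_clique_indep_single (f : V → Fin 3)
    (hf : ∀ u v, u ≠ v → (G.Adj u v ↔
      ((f u : ℕ) + 1 = f v ∨ (f v : ℕ) + 1 = f u) ∨ (f u = f v ∧ f u = 0)))
    (hu : ∀ u v, f u = 2 → f v = 2 → u = v) : Listed G := by
  refine Or.inr (Or.inr (Or.inr (Or.inl ⟨Fintype.card V, Fintype.card V,
    IsPathLabelling.isIndContained (f := f) ⟨fun u v hne => ?_, fun u v huv ha => ?_⟩ ?_⟩)))
  all_goals try have hc : 0 < Fintype.card V := Fintype.card_pos_iff.2 ⟨u⟩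
  · rw [hf u v hne]
    generalize f u = i
    fin_cases i <;> simp [hc]
  · refine hu u v ?_ ?_ <;> [skip; rw [← huv]]
    all_goals
      generalize f u = i at ha ⊢
      fin_cases i <;> simp_all
  · intro i
    fin_cases i <;> simp

lemma of_clique_single_clique (f : V → Fin 3)
    (hf : ∀ u v, u ≠ v → (G.Adj u v ↔
      ((f u : ℕ) + 1 = f v ∨ (f v : ℕ) + 1 = f u) ∨ (f u = f v ∧ f u ≠ 1)))
    (hu : ∀ u v, f u = 1 → f v = 1 → u = v) : Listed G := by
  refine Or.inr (Or.inr (Or.inr (Or.inr (Or.inl ⟨Fintype.card V, Fintype.card V,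
    IsPathLabelling.isIndContained (f := f) ⟨fun u v hne => ?_, fun u v huv ha => ?_⟩ ?_⟩))))
  all_goals try have hc : 0 < Fintype.card V := Fintype.card_pos_iff.2 ⟨u⟩
  · rw [hf u v hne]
    generalize f u = i
    fin_cases i <;> simp [hc]
  · refine hu u v ?_ ?_ <;> [skip; rw [← huv]]
    all_goals
      generalize f u = i at ha ⊢
      fin_cases i <;> simp_all
  · intro i
    fin_cases i <;> simp

lemma of_clique_single_indep (f : V → Fin 3)
    (hf : ∀ u v, u ≠ v → (G.Adj u v ↔
      ((f u : ℕ) + 1 = f v ∨ (f v : ℕ) + 1 = f u) ∨ (f u = f v ∧ f u = 0)))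
    (hu : ∀ u v, f u = 1 → f v = 1 → u = v) : Listed G := by
  refine Or.inr (Or.inr (Or.inr (Or.inr (Or.inr (Or.inr (Or.inr
    ⟨Fintype.card V, Fintype.card V, IsPathLabelling.isIndContained (f := f)
      ⟨fun u v hne => ?_, fun u v huv ha => ?_⟩ ?_⟩))))))
  all_goals try have hc : 0 < Fintype.card V := Fintype.card_pos_iff.2 ⟨u⟩
  · rw [hf u v hne]
    generalize f u = i
    fin_cases i <;> simp [hc]
  · refine hu u v ?_ ?_ <;> [skip; rw [← huv]]
    all_goals
      generalize f u = i at ha ⊢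
      fin_cases i <;> simp_all
  · intro i
    fin_cases i <;> simp

lemma of_path_second (f : V → Fin 4)
    (hf : ∀ u v, u ≠ v → (G.Adj u v ↔
      ((f u : ℕ) + 1 = f v ∨ (f v : ℕ) + 1 = f u) ∨ (f u = f v ∧ f u = 1)))
    (hu : ∀ u v, f u = f v → f u ≠ 1 → u = v) : Listed G := by
  refine Or.inr (Or.inr (Or.inr (Or.inr (Or.inr (Or.inl
    ⟨Fintype.card V, IsPathLabelling.isIndContained (f := f)
      ⟨fun u v hne => ?_, fun u v huv ha => hu u v huv ?_⟩ ?_⟩)))))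
  all_goals try have hc : 0 < Fintype.card V := Fintype.card_pos_iff.2 ⟨u⟩
  · rw [hf u v hne]
    generalize f u = i
    fin_cases i <;> simp [hc]
  · generalize f u = i at ha
    fin_cases i <;> simp_all
  · intro i
    fin_cases i <;> simp

lemma of_path_first (f : V → Fin 4)
    (hf : ∀ u v, u ≠ v → (G.Adj u v ↔
      ((f u : ℕ) + 1 = f v ∨ (f v : ℕ) + 1 = f u) ∨ (f u = f v ∧ f u = 0)))
    (hu : ∀ u v, f u = f v → f u ≠ 0 → u = v) : Listed G := by
  refine Or.inr (Or.inr (Or.inr (Or.inr (Or.inr (Or.inr (Or.inl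
    ⟨Fintype.card V, IsPathLabelling.isIndContained (f := f)
      ⟨fun u v hne => ?_, fun u v huv ha => hu u v huv ?_⟩ ?_⟩))))))
  all_goals try have hc : 0 < Fintype.card V := Fintype.card_pos_iff.2 ⟨u⟩
  · rw [hf u v hne]
    generalize f u = i
    fin_cases i <;> simp [hc]
  · generalize f u = i at ha
    fin_cases i <;> simp_all
  · intro i
    fin_cases i <;> simp

end Listed

/-! ### Diameter at most two -/

/-- A matrix of rank at most two that agrees off the diagonal with the distance matrix of a graph
of diameter at most two. -/
structure IsRealization {K : Type*} [Field K] (G : SimpleGraph V) (M : V → V → K) : Prop where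
  rank : RankLeTwo M
  symm : ∀ u v, M u v = M v u
  adj : ∀ {u v}, G.Adj u v → M u v = 1
  nonadj : ∀ {u v}, u ≠ v → ¬ G.Adj u v → M u v = 2

namespace IsRealization

variable {K : Type*} [Field K] [CharZero K] {M : V → V → K}

lemma adj_iff (h : IsRealization G M) {u v : V} (hne : u ≠ v) : G.Adj u v ↔ M u v = 1 := by
  refine ⟨h.adj, fun h1 => by_contra fun hn => ?_⟩
  have := h.nonadj hne hn
  rw [h1] at this
  norm_num at this

omit [CharZero K] in
lemma one_or_two (h : IsRealization G M) {u v : V} (hne : u ≠ v) :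
    M u v = 1 ∨ M u v = 2 := by
  by_cases hadj : G.Adj u v
  · exact Or.inl (h.adj hadj)
  · exact Or.inr (h.nonadj hne hadj)

lemma not_adj (h : IsRealization G M) {u v : V} (h2 : M u v = 2) : ¬ G.Adj u v := fun h1 => by
  rw [h.adj h1] at h2
  norm_num at h2

/-- An induced path `a, b, c` whose end `a` is labelled `1` and whose centre is labelled `2`. -/
lemma listed_of_path_of_eq_one [Fintype V] (h : IsRealization G M) {a b c : V}
    (hab : M a b = 1) (hac : M a c = 2) (hbc : M b c = 1) (hbb : M b b = 2) (haa : M a a = 1) :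
    Listed G := by
  classical
  -- The principal minor on `a, b` equals 1, so bordering it by `u, v` recovers every entry from the
  -- columns of `a` and `b`.
  have coord : ∀ u v, M u v = 2 * (M u a * M v a) - M u a * M v b -
      M v a * M u b + M u b * M v b := by
    intro u v
    have := h.rank a b u a b v
    rw [h.symm a v, h.symm b v, hbb, h.symm b a, hab, haa] at this
    linear_combination this
  have hca : M c a = 2 := h.symm a c ▸ hac
  have hba : M b a = 1 := h.symm a b ▸ hab
  have hcb : M c b = 1 := h.symm b c ▸ hbc
  have ht : ∀ w, (M w a = 1 ∧ M w b = 1) ∨ (M w a = 1 ∧ M w b = 2) ∨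
      (M w a = 2 ∧ M w b = 1) := by
    intro w
    by_cases hwa : w = a
    · subst hwa
      exact Or.inl ⟨haa, hab⟩
    by_cases hwb : w = b
    · subst hwb
      exact Or.inr (Or.inl ⟨hba, hbb⟩)
    by_cases hwc : w = c
    · subst hwc
      exact Or.inr (Or.inr ⟨hca, hcb⟩)
    rcases h.one_or_two hwa with h1 | h1 <;> rcases h.one_or_two hwb with h3 | h3
    · exact Or.inl ⟨h1, h3⟩
    · exact Or.inr (Or.inl ⟨h1, h3⟩)
    · exact Or.inr (Or.inr ⟨h1, h3⟩)
    -- Such a vertex would have `M w c = 4`.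
    · exfalso
      have hc := coord w c
      rw [h1, h3, hca, hcb] at hc
      rcases h.one_or_two hwc with e | e <;> rw [e] at hc <;> norm_num at hc
  let f : V → Fin 3 := fun w => if M w a = 2 then 2 else if M w b = 2 then 1 else 0
  have hf : ∀ w, (f w = 0 ∧ M w a = 1 ∧ M w b = 1) ∨ (f w = 1 ∧ M w a = 1 ∧ M w b = 2) ∨
      (f w = 2 ∧ M w a = 2 ∧ M w b = 1) := by
    intro w
    rcases ht w with ⟨h1, h3⟩ | ⟨h1, h3⟩ | ⟨h1, h3⟩ <;> simp [f, h1, h3]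
  have huniq : ∀ u v, f u = 2 → f v = 2 → u = v := by
    intro u v hu hv
    by_contra huv
    -- Two vertices of this type would have entry 5 between them.
    have hc := coord u v
    rcases hf u with ⟨h0, h1, h3⟩ | ⟨h0, h1, h3⟩ | ⟨h0, h1, h3⟩ <;>
    rcases hf v with ⟨h0', h1', h3'⟩ | ⟨h0', h1', h3'⟩ | ⟨h0', h1', h3'⟩
    any_goals simp [h0] at hu
    any_goals simp [h0'] at hv
    rw [h1, h3, h1', h3'] at hc
    rcases h.one_or_two huv with e | e <;> rw [e] at hc <;> norm_num at hc
  refine Listed.of_clique_indep_single f (fun u v huv => ?_) huniq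
  rw [h.adj_iff huv]
  have hc := coord u v
  rcases hf u with ⟨h0, h1, h3⟩ | ⟨h0, h1, h3⟩ | ⟨h0, h1, h3⟩ <;>
  rcases hf v with ⟨h0', h1', h3'⟩ | ⟨h0', h1', h3'⟩ | ⟨h0', h1', h3'⟩
  all_goals
    rw [h1, h3, h1', h3'] at hc
    rcases h.one_or_two huv with e | e <;> rw [e] at hc
  all_goals first
    | exfalso; norm_num at hc; done
    | simp [e, h0, h0']

/-- An induced path `a, b, c` whose centre is labelled `2`. -/
lemma listed_of_path [Fintype V] (h : IsRealization G M) (hG : G.Connected) {a b c : V}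
    (hab : M a b = 1) (hac : M a c = 2) (hbc : M b c = 1) (hbb : M b b = 2) : Listed G := by
  classical
  -- The same bordered minor with `M a a` free; the principal minor on `a, b` is now `2 * M a a -
  -- 1`.
  have coord : ∀ u v, M u v * (2 * M a a - 1) = 2 * (M u a * M v a) - M u a * M v b -
      M v a * M u b + M a a * (M u b * M v b) := by
    intro u v
    have := h.rank a b u a b v
    rw [h.symm a v, h.symm b v, hbb, h.symm b a, hab] at this
    linear_combination this
  have hca : M c a = 2 := h.symm a c ▸ hac
  have hba : M b a = 1 := h.symm a b ▸ hab
  have hcb : M c b = 1 := h.symm b c ▸ hbc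
  have hcc := coord c c
  rw [hca, hcb] at hcc
  have hΔ : 2 * M a a - 1 ≠ 0 := by
    intro h0
    have : (9 : K) = 0 := by linear_combination (-2) * hcc + (2 * M c c - 1) * h0
    norm_num at this
  by_cases h2 : M a a = 2
  · -- complete bipartite or tripartite
    have ht : ∀ w, (M w a = 1 ∧ M w b = 1) ∨ (M w a = 2 ∧ M w b = 1) ∨
        (M w a = 1 ∧ M w b = 2) := by
      intro w
      by_cases hwa : w = a
      · subst hwa
        exact Or.inr (Or.inl ⟨h2, hab⟩)
      by_cases hwb : w = b
      · subst hwb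
        exact Or.inr (Or.inr ⟨hba, hbb⟩)
      rcases h.one_or_two hwa with h1 | h1 <;> rcases h.one_or_two hwb with h3 | h3
      · exact Or.inl ⟨h1, h3⟩
      · exact Or.inr (Or.inr ⟨h1, h3⟩)
      · exact Or.inr (Or.inl ⟨h1, h3⟩)
      -- For a neighbour `u` of `w`, `coord` reads `3 = 2 * (M u a + M u b)`, impossible for entries
      -- in {1, 2}.
      · exfalso
        obtain ⟨u, hu⟩ := exists_adj hG hwa
        have hua : u ≠ a := by
          rintro rfl
          exact h.not_adj h1 hu
        have hub : u ≠ b := by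
          rintro rfl
          exact h.not_adj h3 hu
        have := coord w u
        rw [h.adj hu, h1, h3, h2] at this
        rcases h.one_or_two hua with h5 | h5 <;> rcases h.one_or_two hub with h6 | h6 <;>
        · rw [h5, h6] at this
          norm_num at this
    by_cases hx : ∃ w, M w a = 1 ∧ M w b = 1
    · obtain ⟨x, hxa, hxb⟩ := hx
      let f : V → Fin 3 := fun w => if M w a = 2 then 1 else if M w b = 2 then 2 else 0
      have hf : ∀ w, (f w = 0 ∧ M w a = 1 ∧ M w b = 1) ∨ (f w = 1 ∧ M w a = 2 ∧ M w b = 1) ∨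
          (f w = 2 ∧ M w a = 1 ∧ M w b = 2) := by
        intro w
        rcases ht w with ⟨h1, h3⟩ | ⟨h1, h3⟩ | ⟨h1, h3⟩ <;> simp [f, h1, h3]
      -- Two distinct vertices adjacent to both `a` and `b` would have entry 2/3.
      have huniq : ∀ u v, M u a = 1 → M u b = 1 → M v a = 1 → M v b = 1 → u = v := by
        intro u v h1 h3 h4 h5
        by_contra huv
        have := coord u v
        rw [h1, h3, h4, h5, h2] at this
        rcases h.one_or_two huv with h6 | h6 <;> rw [h6] at this <;> norm_num at this
      refine Listed.of_tripartite f (fun u v huv => ?_) ⟨x, ?_, fun y hy => ?_⟩ ⟨a, ?_⟩ ⟨b, ?_⟩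
      · rw [h.adj_iff huv]
        rcases hf u with ⟨h0, h1, h3⟩ | ⟨h0, h1, h3⟩ | ⟨h0, h1, h3⟩ <;>
        rcases hf v with ⟨h0', h1', h3'⟩ | ⟨h0', h1', h3'⟩ | ⟨h0', h1', h3'⟩
        · exact (huv (huniq u v h1 h3 h1' h3')).elim
        all_goals
          have hc := coord u v
          rw [h1, h3, h1', h3', h2] at hc
          rcases h.one_or_two huv with e | e <;> rw [e] at hc
        all_goals first
          | exfalso; norm_num at hc; done
          | simp [e, h0, h0']
      · simp [f, hxa, hxb]
      · rcases hf y with ⟨h0, h1, h3⟩ | ⟨h0, h1, h3⟩ | ⟨h0, h1, h3⟩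
        · exact huniq y x h1 h3 hxa hxb
        all_goals simp [h0] at hy
      · simp [f, h2]
      · simp [f, hba, hbb]
    · refine Listed.of_bipartite {w | M w a = 2} ⟨a, h2⟩ ⟨b, by simp [hba]⟩ fun u v huv => ?_
      rw [h.adj_iff huv, Set.mem_ofPred_eq, Set.mem_ofPred_eq]
      have hc := coord u v
      rcases (ht u).resolve_left fun h' => hx ⟨u, h'⟩ with ⟨h1, h3⟩ | ⟨h1, h3⟩ <;>
      rcases (ht v).resolve_left fun h' => hx ⟨v, h'⟩ with ⟨h1', h3'⟩ | ⟨h1', h3'⟩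
      all_goals
        rw [h1, h3, h1', h3', h2] at hc
        rcases h.one_or_two huv with e | e <;> rw [e] at hc
      all_goals first
        | exfalso; norm_num at hc; done
        | simp [e, h1, h1']
  by_cases h1 : M a a = 1
  · exact h.listed_of_path_of_eq_one hab hac hbc hbb h1
  by_cases h4 : M c c = 1
  · exact h.listed_of_path_of_eq_one hcb hca hba hbb h4
  -- the complete bipartite graph with the part `{a, c}`
  have ht : ∀ w, w = a ∨ w = c ∨ (M w a = 1 ∧ M w b = 2) := by
    intro w
    by_cases hwa : w = a
    · exact Or.inl hwa
    by_cases hwc : w = c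
    · exact Or.inr (Or.inl hwc)
    by_cases hwb : w = b
    · subst hwb
      exact Or.inr (Or.inr ⟨hba, hbb⟩)
    refine Or.inr (Or.inr ?_)
    -- Any other pair of entries is either contradictory or forces `M a a` to be 1, 2 or 5, and the
    -- value 5 gives `M c c = 1`; all of these are excluded.
    have hw := coord w c
    rw [hca, hcb] at hw
    rcases h.one_or_two hwa with h5 | h5 <;> rcases h.one_or_two hwb with h6 | h6 <;>
    rcases h.one_or_two hwc with h7 | h7 <;> rw [h5, h6, h7] at hw
    · exact (h2 (by linear_combination hw)).elim
    · exact (h1 (by linear_combination hw / 3)).elim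
    · exact ⟨h5, h6⟩
    · exact ⟨h5, h6⟩
    · have ha : M a a = 5 := by linear_combination hw
      rw [ha] at hcc
      exact (h4 (by linear_combination hcc / 9)).elim
    · exact (h2 (by linear_combination hw / 3)).elim
    · have : (3 : K) = 0 := by linear_combination -hw
      norm_num at this
    · exact (h2 (by linear_combination hw / 2)).elim
  refine Listed.of_bipartite {w | M w b = 1} ⟨a, hab⟩ ⟨b, by simp [hbb]⟩ fun u v huv => ?_
  rw [h.adj_iff huv, Set.mem_ofPred_eq, Set.mem_ofPred_eq]
  rcases ht u with rfl | rfl | ⟨h5, h6⟩ <;> rcases ht v with rfl | rfl | ⟨h5', h6'⟩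
  · exact (huv rfl).elim
  · simp [hac, hab, hcb]
  · simp [h.symm u v, hab, h5', h6']
  · simp [hca, hab, hcb]
  · exact (huv rfl).elim
  · have hc := coord u v
    rw [hca, hcb, h5', h6'] at hc
    have e : M u v = 1 := mul_right_cancel₀ hΔ (by linear_combination hc)
    simp [e, hcb, h6']
  · simp [h5, h6, hab]
  · have hc := coord u v
    rw [h5, h6, hca, hcb] at hc
    have e : M u v = 1 := mul_right_cancel₀ hΔ (by linear_combination hc)
    simp [e, hcb, h6]
  · have hc := coord u v
    rw [h5, h6, h5', h6'] at hc
    have e : M u v = 2 := mul_right_cancel₀ hΔ (by linear_combination hc)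
    simp [e, h6, h6']

/-- The minor with rows `a, c, b` and columns `a, b, d` is, up to sign, `(M a a - 2) * (M b b - 2)`.
Hence `a` or `b` has label 2, and each is the centre of an induced path in the square. -/
lemma listed_of_square [Fintype V] (h : IsRealization G M) (hG : G.Connected) {a b c d : V}
    (hab : G.Adj a b) (hbc : G.Adj b c) (hcd : G.Adj c d) (hda : G.Adj d a)
    (hac : ¬ G.Adj a c) (hbd : ¬ G.Adj b d) (hac' : a ≠ c) (hbd' : b ≠ d) : Listed G := by
  have h1 := h.adj hab
  have h2 := h.adj hbc
  have h3 := h.adj hcd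
  have h4 := h.adj hda
  have h5 := h.nonadj hac' hac
  have h6 := h.nonadj hbd' hbd
  by_cases hb : M b b = 2
  · exact h.listed_of_path hG h1 h5 h2 hb
  · have key := h.rank a c b a b d
    rw [h1, h.symm c a, h5, h.symm c b, h2, h3, h.symm b a, h1, h6, h.symm a d, h4] at key
    have ha : M a a = 2 := by
      refine sub_eq_zero.1 ((mul_eq_zero.1 ?_).resolve_right (sub_ne_zero.2 hb))
      linear_combination -key
    exact h.listed_of_path hG ((h.symm b a).trans h1) h6 ((h.symm a d).trans h4) ha

/-- In a graph without induced four-cycles, a vertex of maximum degree is adjacent to all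
others. -/
lemma listed_or_exists_universal [Fintype V] (h : IsRealization G M) (hG : G.Connected)
    (hdiam : ∀ u v, u ≠ v → ¬ G.Adj u v → ∃ w, G.Adj u w ∧ G.Adj w v) :
    Listed G ∨ ∃ v, ∀ u, u ≠ v → G.Adj v u := by
  classical
  by_cases hsq : ∃ a b c d, G.Adj a b ∧ G.Adj b c ∧ G.Adj c d ∧ G.Adj d a ∧ ¬ G.Adj a c ∧
      ¬ G.Adj b d ∧ a ≠ c ∧ b ≠ d
  · obtain ⟨a, b, c, d, h1, h2, h3, h4, h5, h6, h7, h8⟩ := hsq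
    exact Or.inl (h.listed_of_square hG h1 h2 h3 h4 h5 h6 h7 h8)
  right
  push Not at hsq
  have : Nonempty V := hG.nonempty
  obtain ⟨v, -, hv⟩ := Finset.exists_max_image Finset.univ (fun v => G.degree v)
    Finset.univ_nonempty
  refine ⟨v, fun u huv => ?_⟩
  by_contra hadj
  obtain ⟨w, hvw, hwu⟩ := hdiam v u huv.symm hadj
  -- Otherwise `w` would be adjacent to `v`, to all other neighbours of `v` and also to `u`,
  -- exceeding the maximum degree.
  obtain ⟨x, hvx, hwx, hxw⟩ : ∃ x, G.Adj v x ∧ ¬ G.Adj w x ∧ x ≠ w := by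
    by_contra! hcon
    have hsub : insert u (insert v ((G.neighborFinset v).erase w)) ⊆ G.neighborFinset w := by
      intro x hx
      rw [Finset.mem_insert, Finset.mem_insert, Finset.mem_erase,
        SimpleGraph.mem_neighborFinset] at hx
      rw [SimpleGraph.mem_neighborFinset]
      rcases hx with rfl | rfl | ⟨hne, hx⟩
      · exact hwu
      · exact hvw.symm
      · by_contra hn
        exact hne (hcon x hx hn)
    have hle := Finset.card_le_card hsub
    rw [Finset.card_insert_of_notMem, Finset.card_insert_of_notMem,
      Finset.card_erase_of_mem, SimpleGraph.card_neighborFinset_eq_degree,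
      SimpleGraph.card_neighborFinset_eq_degree] at hle
    · have := hv w (Finset.mem_univ w)
      omega
    · rwa [SimpleGraph.mem_neighborFinset]
    · simp
    · simp [huv, hadj]
  have hxu : ¬ G.Adj x u := by
    intro hxu
    have := hsq x v w u hvx.symm hvw hwu hxu.symm (fun h' => hwx h'.symm) hadj hxw
    exact huv this.symm
  have hxu' : x ≠ u := by
    rintro rfl
    exact hadj hvx
  obtain ⟨e, hxe, heu⟩ := hdiam x u hxu' hxu
  have hev : e ≠ v := by
    rintro rfl
    exact hadj heu
  have hew : e ≠ w := by
    rintro rfl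
    exact hwx hxe.symm
  have a1 := h.adj hvx
  have a2 := h.adj hvw
  have a3 := h.adj hwu
  have a4 := h.adj hxe
  have a5 := h.adj heu
  have b1 := h.nonadj hxw.symm hwx
  have b2 := h.nonadj hxu' hxu
  have b3 := h.nonadj huv.symm hadj
  by_cases hve : G.Adj v e
  · by_cases hwe : G.Adj w e
    · -- the gem
      have c1 := h.adj hve
      have c2 := h.adj hwe
      -- The two minors force the label of the hub `e` to be both 1/2 and 1.
      have r1 := h.rank e x v e w u
      have r2 := h.rank e x w e v u
      rw [h.symm x w, h.symm e w] at r1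
      rw [h.symm x v, h.symm e v, h.symm w v] at r2
      simp only [a1, a2, a3, a4, a5, b1, b2, b3, c1, c2] at r1 r2
      have : (1 : K) = 0 := by linear_combination r1 + 2 * r2
      norm_num at this
    · exact hew (hsq v w u e hvw hwu heu.symm hve.symm hadj hwe huv.symm).symm
  · by_cases hwe : G.Adj w e
    · exact hev (hsq x v w e hvx.symm hvw hwe hxe.symm (fun h' => hwx h'.symm) hve hxw).symm
    · -- the five-cycle `x, v, w, u, e`
      have c1 := h.nonadj hev.symm hve
      have c2 := h.nonadj hew.symm hwe
      -- The two minors force `M x x` to be both -1/2 and 5.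
      have r1 := h.rank x v w x u e
      have r2 := h.rank x v u x w e
      rw [h.symm x w, h.symm u x, h.symm u w, h.symm u e] at r2
      simp only [a1, a2, a3, a4, a5, b1, b2, b3, c1, c2] at r1 r2
      have : (11 : K) = 0 := by linear_combination r1 + 2 * r2
      norm_num at this

/-- A vertex `v` adjacent to all others and an induced path with centre `b` avoiding `v`. -/
lemma listed_of_universal_of_path [Fintype V] (h : IsRealization G M) {v a b c : V}
    (hv : ∀ u, u ≠ v → G.Adj v u) (hab : G.Adj a b) (hbc : G.Adj b c) (hac : ¬ G.Adj a c)
    (hne : a ≠ c) (hbv : b ≠ v) : Listed G := by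
  classical
  have hav : a ≠ v := by
    rintro rfl
    exact hac (hv c hne.symm)
  have hcv : c ≠ v := by
    rintro rfl
    exact hac (hv a hne).symm
  have mva := h.adj (hv a hav)
  have mvb := h.adj (hv b hbv)
  have mvc := h.adj (hv c hcv)
  have mav := h.symm a v ▸ mva
  have mbv := h.symm b v ▸ mvb
  have mcv := h.symm c v ▸ mvc
  have mab := h.adj hab
  have mbc := h.adj hbc
  have mba := h.symm a b ▸ mab
  have mcb := h.symm b c ▸ mbc
  have mac := h.nonadj hne hac
  have mca := h.symm a c ▸ mac
  have r1 := h.rank a b v c b v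
  have r2 := h.rank a c b a b v
  have r3 := h.rank a c b a c b
  have r4 := h.rank a c v a v b
  rw [mac, mab, mav, mbc, mbv, mvc, mvb] at r1
  rw [mca, mab, mav, mcb, mcv, mba, mbv] at r2
  rw [mca, mab, mac, mcb, mba, mbc] at r3
  rw [mca, mab, mav, mcb, mcv, mva, mvb] at r4
  -- The relations `r2` and `r4` factor as `(M a a - 2) * (1 - M b b) = 0` and `(M a a - 2) * (1 - M
  -- v v) = 0`.
  by_cases ha : M a a = 2
  · have coord : ∀ u w, u ≠ v → w ≠ v → M u w * (2 * M v v - 1) =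
        M v v * (M u a * M w a) - M u a - M w a + 2 := by
      intro u w hu hw
      have := h.rank a v u a v w
      rw [ha, mav, mva, h.symm a w, h.adj (hv w hw), h.symm u v, h.adj (hv u hu)] at this
      linear_combination this
    -- `r1` says `2 * M b b * M v v = M b b + M v v`, which fails when `M v v = 1/2`.
    have hΔ : 2 * M v v - 1 ≠ 0 := by
      intro h0
      have : (1 : K) = 0 := by linear_combination (2 * M b b - 1) * h0 - 2 * r1
      norm_num at this
    have hx : ∀ w, M w a = 1 ∨ M w a = 2 := by
      intro w
      by_cases hwa : w = a
      · subst hwa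
        exact Or.inr ha
      · exact h.one_or_two hwa
    have h22 : ∀ u w, u ≠ v → w ≠ v → M u a = 2 → M w a = 2 → M u w = 2 := by
      intro u w hu hw h1 h2
      have hc := coord u w hu hw
      rw [h1, h2] at hc
      exact mul_right_cancel₀ hΔ (by linear_combination hc)
    have h12 : ∀ u w, u ≠ v → w ≠ v → M u a = 1 → M w a = 2 → M u w = 1 := by
      intro u w hu hw h1 h2
      have hc := coord u w hu hw
      rw [h1, h2] at hc
      exact mul_right_cancel₀ hΔ (by linear_combination hc)
    have h11 : ∀ u w, u ≠ v → w ≠ v → M u a = 1 → M w a = 1 →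
        M u w * (2 * M v v - 1) = M v v := by
      intro u w hu hw h1 h2
      have hc := coord u w hu hw
      rw [h1, h2] at hc
      linear_combination hc
    -- By `h11` the neighbours of `a` other than `v` form a clique if `M v v = 1`; otherwise they
    -- are independent, and the graph is tripartite with single part `{v}`.
    by_cases hv1 : M v v = 1
    · refine Listed.of_split {w | M w a = 2} ⟨a, ha⟩ fun u w huw => ?_
      rw [h.adj_iff huw, Set.mem_ofPred_eq, Set.mem_ofPred_eq]
      by_cases hu : u = v
      · subst hu
        simp [h.adj (hv w huw.symm), mva]
      by_cases hw : w = v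
      · subst hw
        simp [h.symm u w, h.adj (hv u huw), mva]
      rcases hx u with h1 | h1 <;> rcases hx w with h2 | h2
      · have := h11 u w hu hw h1 h2
        rw [hv1] at this
        have e : M u w = 1 := by linear_combination this
        simp [e, h1]
      · simp [h12 u w hu hw h1 h2, h1]
      · simp [h.symm u w, h12 w u hw hu h2 h1, h2]
      · simp [h22 u w hu hw h1 h2, h1, h2]
    · let f : V → Fin 3 := fun w => if w = v then 0 else if M w a = 2 then 1 else 2
      have fv : f v = 0 := by simp [f]
      have f1 : ∀ w, w ≠ v → M w a = 1 → f w = 2 := fun w hw h1 => by simp [f, hw, h1]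
      have f2 : ∀ w, w ≠ v → M w a = 2 → f w = 1 := fun w hw h1 => by simp [f, hw, h1]
      have f0 : ∀ w, w ≠ v → f w ≠ 0 := by
        intro w hw
        rcases hx w with h1 | h1
        · simp [f1 w hw h1]
        · simp [f2 w hw h1]
      refine Listed.of_tripartite f (fun u w huw => ?_)
        ⟨v, fv, fun y hy => by_contra fun hyv => f0 y hyv hy⟩ ⟨a, f2 a hav ha⟩ ⟨b, f1 b hbv mba⟩
      by_cases hu : u = v
      · subst hu
        simp [hv w huw.symm, fv, (f0 w huw.symm).symm]
      by_cases hw : w = v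
      · subst hw
        simp [(hv u huw).symm, fv, f0 u huw]
      rw [h.adj_iff huw]
      rcases hx u with h1 | h1 <;> rcases hx w with h2 | h2
      · have h3 := h11 u w hu hw h1 h2
        rcases h.one_or_two huw with e | e
        · rw [e] at h3
          exact (hv1 (by linear_combination h3)).elim
        · simp [e, f1 u hu h1, f1 w hw h2]
      · simp [h12 u w hu hw h1 h2, f1 u hu h1, f2 w hw h2]
      · simp [h.symm u w, h12 w u hw hu h2 h1, f2 u hu h1, f1 w hw h2]
      · simp [h22 u w hu hw h1 h2, f2 u hu h1, f2 w hw h2]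
  · have hb1 : M b b = 1 := by
      refine sub_eq_zero.1 ((mul_eq_zero.1 ?_).resolve_left (sub_ne_zero.2 ha))
      linear_combination -r2
    have hv1 : M v v = 1 := by
      refine sub_eq_zero.1 ((mul_eq_zero.1 ?_).resolve_left (sub_ne_zero.2 ha))
      linear_combination -r4
    rw [hb1] at r3
    have hΔ : M a a - 1 ≠ 0 := by
      intro h0
      have : (1 : K) = 0 := by linear_combination (M c c - 1) * h0 - r3
      norm_num at this
    have coord : ∀ u w, u ≠ v → w ≠ v → M u w * (M a a - 1) =
        M u a * M w a - M u a - M w a + M a a := by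
      intro u w hu hw
      have := h.rank a v u a v w
      rw [hv1, mav, mva, h.symm a w, h.adj (hv w hw), h.symm u v, h.adj (hv u hu)] at this
      linear_combination this
    -- In this branch `c` is the only non-neighbour of `a`, so the graph turns out to be complete
    -- minus the edge `ac`.
    have hx : ∀ w, w ≠ v → w ≠ a → w ≠ c → M w a = 1 := by
      intro w hwv hwa hwc
      refine (h.one_or_two hwa).resolve_right fun h2 => ?_
      have hc := coord w c hwv hcv
      rw [h2, mca] at hc
      rcases h.one_or_two hwc with e | e <;> rw [e] at hc
      · have : (1 : K) = 0 := by linear_combination -hc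
        norm_num at this
      · exact ha (by linear_combination hc)
    have h1x : ∀ u w, u ≠ a → u ≠ c → u ≠ w → M u w = 1 := by
      intro u w hua huc huw
      by_cases hu : u = v
      · subst hu
        exact h.adj (hv w huw.symm)
      by_cases hw : w = v
      · subst hw
        exact h.symm u w ▸ h.adj (hv u huw)
      have hc := coord u w hu hw
      rw [hx u hu hua huc] at hc
      exact mul_right_cancel₀ hΔ (by linear_combination hc)
    refine Listed.of_split {a, c} ⟨a, by simp⟩ fun u w huw => ?_
    rw [h.adj_iff huw]
    by_cases hu : u = a ∨ u = c
    · by_cases hw : w = a ∨ w = c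
      · rcases hu with rfl | rfl <;> rcases hw with rfl | rfl
        · exact (huw rfl).elim
        · simp [mac]
        · simp [mca]
        · exact (huw rfl).elim
      · rw [h.symm u w, h1x w u (fun h' => hw (Or.inl h')) (fun h' => hw (Or.inr h')) huw.symm]
        simpa using fun _ => hw
    · rw [h1x u w (fun h' => hu (Or.inl h')) (fun h' => hu (Or.inr h')) huw]
      simp only [true_iff]
      exact fun h' => hu h'.1

/-- The minors with rows `v, x, y` and columns `v, x', y'` or `v, x', z` give `M v v = 2/3` and `M v
v = 1/2`. This excludes two disjoint cliques with an edge each alongside a third clique. -/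
lemma false_of_two_edges_of_universal (h : IsRealization G M) {v x x' y y' z : V}
    (hv : ∀ u, u ≠ v → G.Adj v u) (hx : x ≠ v) (hx' : x' ≠ v) (hy : y ≠ v) (hy' : y' ≠ v)
    (hz : z ≠ v) (hxx : G.Adj x x') (hyy : G.Adj y y') (hxy : M x y' = 2) (hyx : M y x' = 2)
    (hxz : M x z = 2) (hyz : M y z = 2) : False := by
  have r1 := h.rank v x y v x' y'
  have r2 := h.rank v x y v x' z
  rw [h.symm x v, h.symm y v, h.adj (hv x hx), h.adj (hv y hy), h.adj (hv x' hx'), h.adj hxx,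
    hyx] at r1 r2
  rw [h.adj (hv y' hy'), hxy, h.adj hyy] at r1
  rw [h.adj (hv z hz), hxz, hyz] at r2
  have : (1 : K) = 0 := by linear_combination 2 * r1 - 3 * r2
  norm_num at this

/-- A vertex adjacent to all others whose deletion leaves a disjoint union of cliques. -/
lemma listed_of_universal_of_trans [Fintype V] (h : IsRealization G M) {v : V}
    (hv : ∀ u, u ≠ v → G.Adj v u)
    (htrans : ∀ a b c, b ≠ v → G.Adj a b → G.Adj b c → a ≠ c → G.Adj a c) : Listed G := by
  classical
  by_cases hsub : ∀ u, u = v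
  · exact Listed.of_split {v} ⟨v, rfl⟩ fun u w huw => (huw ((hsub u).trans (hsub w).symm)).elim
  push Not at hsub
  -- The vertex `x` is taken from a clique with at least two vertices whenever one exists.
  obtain ⟨x, hxv, hx⟩ : ∃ x, x ≠ v ∧
      ((∃ x', x' ≠ v ∧ G.Adj x x') ∨ ∀ a b, a ≠ v → b ≠ v → ¬ G.Adj a b) := by
    by_cases hed : ∃ a b, a ≠ v ∧ b ≠ v ∧ G.Adj a b
    · obtain ⟨a, b, ha, hb, hab⟩ := hed
      exact ⟨a, ha, Or.inl ⟨b, hb, hab⟩⟩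
    · obtain ⟨x, hx⟩ := hsub
      exact ⟨x, hx, Or.inr fun a b ha hb hab => hed ⟨a, b, ha, hb, hab⟩⟩
  let f : V → Fin 3 := fun w => if w = v then 1 else if w = x ∨ G.Adj w x then 0 else 2
  have f1 : f v = 1 := by simp [f]
  have f0 : ∀ w, w ≠ v → (w = x ∨ G.Adj w x) → f w = 0 := fun w hw h1 => by simp [f, hw, h1]
  have f2 : ∀ w, w ≠ v → ¬ (w = x ∨ G.Adj w x) → f w = 2 := fun w hw h1 => by
    simp only [f, hw, h1, if_false]
  have fne : ∀ w, w ≠ v → f w ≠ 1 := by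
    intro w hw
    by_cases h1 : w = x ∨ G.Adj w x
    · simp [f0 w hw h1]
    · simp [f2 w hw h1]
  have funiq : ∀ u w, f u = 1 → f w = 1 → u = w := fun u w hu hw =>
    (by_contra fun h' => fne u h' hu : u = v).trans (by_contra fun h' => fne w h' hw : w = v).symm
  have hXX : ∀ u w, u ≠ w → (u = x ∨ G.Adj u x) → (w = x ∨ G.Adj w x) → G.Adj u w := by
    rintro u w huw (rfl | hu) (rfl | hw)
    · exact (huw rfl).elim
    · exact hw.symm
    · exact hu
    · exact htrans u x w hxv hu hw.symm huw
  have hXn : ∀ u w, u ≠ v → (u = x ∨ G.Adj u x) → ¬ (w = x ∨ G.Adj w x) → ¬ G.Adj w u := by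
    rintro u w hu (rfl | hux) hw hadj
    · exact hw (Or.inr hadj)
    · exact hw (or_iff_not_imp_left.2 fun hwx => htrans w u x hu hadj hux hwx)
  by_cases hall : ∀ u w, u ≠ v → w ≠ v → u ≠ w → ¬ (u = x ∨ G.Adj u x) →
      ¬ (w = x ∨ G.Adj w x) → G.Adj u w
  · refine Listed.of_clique_single_clique f (fun u w huw => ?_) funiq
    by_cases hu : u = v
    · subst hu
      by_cases h1 : w = x ∨ G.Adj w x
      · simp [hv w huw.symm, f1, f0 w huw.symm h1]
      · simp [hv w huw.symm, f1, f2 w huw.symm h1]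
    by_cases hw : w = v
    · subst hw
      by_cases h1 : u = x ∨ G.Adj u x
      · simp [(hv u huw).symm, f1, f0 u huw h1]
      · simp [(hv u huw).symm, f1, f2 u huw h1]
    by_cases h1 : u = x ∨ G.Adj u x <;> by_cases h2 : w = x ∨ G.Adj w x
    · simp [f0 u hu h1, f0 w hw h2, hXX u w huw h1 h2]
    · simp [f0 u hu h1, f2 w hw h2, G.adj_comm u w, hXn u w hu h1 h2]
    · simp [f2 u hu h1, f0 w hw h2, hXn w u hw h2 h1]
    · simp [f2 u hu h1, f2 w hw h2, hall u w hu hw huw h1 h2]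
  by_cases hnone : ∀ u w, u ≠ v → w ≠ v → u ≠ w → ¬ (u = x ∨ G.Adj u x) →
      ¬ (w = x ∨ G.Adj w x) → ¬ G.Adj u w
  · refine Listed.of_clique_single_indep f (fun u w huw => ?_) funiq
    by_cases hu : u = v
    · subst hu
      by_cases h1 : w = x ∨ G.Adj w x
      · simp [hv w huw.symm, f1, f0 w huw.symm h1]
      · simp [hv w huw.symm, f1, f2 w huw.symm h1]
    by_cases hw : w = v
    · subst hw
      by_cases h1 : u = x ∨ G.Adj u x
      · simp [(hv u huw).symm, f1, f0 u huw h1]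
      · simp [(hv u huw).symm, f1, f2 u huw h1]
    by_cases h1 : u = x ∨ G.Adj u x <;> by_cases h2 : w = x ∨ G.Adj w x
    · simp [f0 u hu h1, f0 w hw h2, hXX u w huw h1 h2]
    · simp [f0 u hu h1, f2 w hw h2, G.adj_comm u w, hXn u w hu h1 h2]
    · simp [f2 u hu h1, f0 w hw h2, hXn w u hw h2 h1]
    · simp [f2 u hu h1, f2 w hw h2, hnone u w hu hw huw h1 h2]
  exfalso
  push Not at hall hnone
  obtain ⟨z, w, hzv, hwv, hzw, hz, hw, hzwn⟩ := hall
  obtain ⟨y, y', hyv, hyv', -, hy, hy', hyy⟩ := hnone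
  obtain ⟨x', hxv', hxx⟩ := hx.resolve_right fun h' => h' y y' hyv hyv' hyy
  rw [← not_or] at hz hw hy hy'
  -- Outside the clique of `x` there are both an edge `y y'` and a non-adjacent pair; some vertex of
  -- that pair lies outside the clique of `y`, in a third clique.
  have key : ∀ z, z ≠ v → ¬ (z = x ∨ G.Adj z x) → z ≠ y → ¬ G.Adj z y → False := by
    intro z hzv hz hzy hzyn
    refine h.false_of_two_edges_of_universal hv hxv hxv' hyv hyv' hzv hxx hyy ?_ ?_ ?_ ?_
    · exact h.nonadj (fun h' => hy' (Or.inl h'.symm)) fun h' => hy' (Or.inr h'.symm)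
    · refine h.nonadj (fun h' => hy (Or.inr ?_)) (hXn x' y hxv' (Or.inr hxx.symm) (by tauto))
      exact h' ▸ hxx.symm
    · exact h.nonadj (fun h' => hz (Or.inl h'.symm)) fun h' => hz (Or.inr h'.symm)
    · exact h.nonadj hzy.symm fun h' => hzyn h'.symm
  by_cases hzy : z = y
  · subst hzy
    exact key w hwv (by tauto) hzw.symm fun h' => hzwn h'.symm
  by_cases hwy : w = y
  · subst hwy
    exact key z hzv (by tauto) hzw hzwn
  by_cases hzya : G.Adj z y
  · refine key w hwv (by tauto) hwy fun h' => hzwn ?_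
    exact htrans z y w hyv hzya h'.symm hzw
  · exact key z hzv (by tauto) hzy hzya

/-- The classification for graphs of diameter at most two. -/
lemma listed [Fintype V] (h : IsRealization G M) (hG : G.Connected)
    (hdiam : ∀ u v, u ≠ v → ¬ G.Adj u v → ∃ w, G.Adj u w ∧ G.Adj w v) : Listed G := by
  rcases h.listed_or_exists_universal hG hdiam with hl | ⟨v, hv⟩
  · exact hl
  by_cases hp : ∃ a b c, b ≠ v ∧ G.Adj a b ∧ G.Adj b c ∧ a ≠ c ∧ ¬ G.Adj a c
  · obtain ⟨a, b, c, hb, hab, hbc, hne, hac⟩ := hp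
    exact h.listed_of_universal_of_path hv hab hbc hac hne hb
  · push Not at hp
    exact h.listed_of_universal_of_trans hv hp

end IsRealization

/-! ### Graphs with two vertices at distance three -/

lemma exists_adj_dist_eq {u v : V} (hG : G.Connected) {n : ℕ} (h : G.dist u v = n + 1) :
    ∃ w, G.Adj u w ∧ G.dist w v = n := by
  obtain ⟨p, hp⟩ := hG.exists_walk_length_eq_dist u v
  rw [h] at hp
  cases p with
  | nil => simp at hp
  | @cons _ w _ hw q =>
    rw [SimpleGraph.Walk.length_cons, Nat.add_right_cancel_iff] at hp
    refine ⟨w, hw, le_antisymm (hp ▸ SimpleGraph.dist_le q) ?_⟩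
    have := hG.dist_triangle (u := u) (v := w) (w := v)
    rw [SimpleGraph.dist_eq_one_iff_adj.2 hw] at this
    omega

lemma exists_dist_eq {v : V} (hG : G.Connected) {n m : ℕ} (hnm : n ≤ m) :
    ∀ u, G.dist u v = m → ∃ w, G.dist w v = n := by
  induction m, hnm using Nat.le_induction with
  | base => exact fun u hu => ⟨u, hu⟩
  | succ m _ ih =>
    intro u hu
    obtain ⟨w, -, hw⟩ := exists_adj_dist_eq hG hu
    exact ih w hw

/-- A matrix of rank at most two that agrees off the diagonal with the distance matrix. -/
structure IsDistRealization {K : Type*} [Field K] (G : SimpleGraph V) (M : V → V → K) :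
    Prop where
  rank : RankLeTwo M
  symm : ∀ u v, M u v = M v u
  eq_dist : ∀ {u v}, u ≠ v → M u v = G.dist u v

/-- The vertices `a, b, c, d` form a shortest path. -/
structure IsGeodesicFour (G : SimpleGraph V) (a b c d : V) : Prop where
  ab : G.dist a b = 1
  bc : G.dist b c = 1
  cd : G.dist c d = 1
  ac : G.dist a c = 2
  bd : G.dist b d = 2
  ad : G.dist a d = 3

lemma IsGeodesicFour.reverse {a b c d : V} (h : IsGeodesicFour G a b c d) :
    IsGeodesicFour G d c b a := by
  obtain ⟨h1, h2, h3, h4, h5, h6⟩ := h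
  constructor <;> rw [G.dist_comm] <;> assumption

lemma exists_isGeodesicFour {a d : V} (hG : G.Connected) (h : G.dist a d = 3) :
    ∃ b c, IsGeodesicFour G a b c d := by
  obtain ⟨b, hab, hbd⟩ := exists_adj_dist_eq hG h
  obtain ⟨c, hbc, hcd⟩ := exists_adj_dist_eq hG hbd
  rw [← SimpleGraph.dist_eq_one_iff_adj] at hab hbc
  refine ⟨b, c, hab, hbc, hcd, ?_, hbd, h⟩
  have h1 := hG.dist_triangle (u := a) (v := b) (w := c)
  have h2 := hG.dist_triangle (u := a) (v := c) (w := d)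
  omega

/-- The vertex `b` is not singled out: it belongs to the clique replacing the second vertex of the
path. -/
lemma listed_of_blowup_path_second [Fintype V] {a b c d : V} (h : IsGeodesicFour G a b c d)
    (hw : ∀ w, w = a ∨ w = c ∨ w = d ∨ (w ≠ a ∧ w ≠ c ∧ w ≠ d ∧
      G.Adj w a ∧ G.Adj w c ∧ ¬ G.Adj w d))
    (hpair : ∀ u w, u ≠ w → u ≠ a → u ≠ c → u ≠ d → w ≠ a → w ≠ c → w ≠ d → G.Adj u w) :
    Listed G := by
  classical
  have hac : ¬ G.Adj a c := by simp [← SimpleGraph.dist_eq_one_iff_adj, h.ac]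
  have had : ¬ G.Adj a d := by simp [← SimpleGraph.dist_eq_one_iff_adj, h.ad]
  have hcd : G.Adj c d := SimpleGraph.dist_eq_one_iff_adj.1 h.cd
  have nac : a ≠ c := by rintro rfl; simpa using h.ac
  have nad : a ≠ d := by rintro rfl; simpa using h.ad
  have ncd : c ≠ d := hcd.ne
  let f : V → Fin 4 := fun w => if w = a then 0 else if w = c then 2 else if w = d then 3 else 1
  have fa : f a = 0 := by simp [f]
  have fc : f c = 2 := by simp [f, nac.symm]
  have fd : f d = 3 := by simp [f, nad.symm, ncd.symm]
  have f1 : ∀ w, w ≠ a → w ≠ c → w ≠ d → f w = 1 := fun w h1 h2 h3 => by simp [f, h1, h2, h3]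
  refine Listed.of_path_second f (fun u w huw => ?_) fun u w huw hu => ?_
  · rcases hw u with rfl | rfl | rfl | ⟨h1, h2, h3, h4, h5, h6⟩ <;>
    rcases hw w with rfl | rfl | rfl | ⟨h1', h2', h3', h4', h5', h6'⟩
    all_goals first
      | exact (huw rfl).elim
      | simp [fa, fc, fd, hac, had, hcd, mt G.adj_symm hac, mt G.adj_symm had, hcd.symm]; done
      | simp [fa, fc, fd, f1 w h1' h2' h3', h4'.symm, h5'.symm, mt G.adj_symm h6']; done
      | simp [fa, fc, fd, f1 u h1 h2 h3, h4, h5, h6]; done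
      | simp [f1 w h1' h2' h3', f1 u h1 h2 h3, hpair u w huw h1 h2 h3 h1' h2' h3']
  · rcases hw u with rfl | rfl | rfl | ⟨h1, h2, h3, -⟩ <;>
    rcases hw w with rfl | rfl | rfl | ⟨h1', h2', h3', -⟩
    all_goals first
      | rfl
      | exact (hu (f1 u h1 h2 h3)).elim
      | simp [fa, fc, fd] at huw; done
      | simp [fa, fc, fd, f1 w h1' h2' h3'] at huw

lemma listed_of_blowup_path_first [Fintype V] {a b c d : V} (h : IsGeodesicFour G a b c d)
    (hw : ∀ w, w = b ∨ w = c ∨ w = d ∨ (w ≠ b ∧ w ≠ c ∧ w ≠ d ∧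
      G.Adj w b ∧ ¬ G.Adj w c ∧ ¬ G.Adj w d))
    (hpair : ∀ u w, u ≠ w → u ≠ b → u ≠ c → u ≠ d → w ≠ b → w ≠ c → w ≠ d → G.Adj u w) :
    Listed G := by
  classical
  have hbc : G.Adj b c := SimpleGraph.dist_eq_one_iff_adj.1 h.bc
  have hcd : G.Adj c d := SimpleGraph.dist_eq_one_iff_adj.1 h.cd
  have hbd : ¬ G.Adj b d := by simp [← SimpleGraph.dist_eq_one_iff_adj, h.bd]
  have nbc : b ≠ c := hbc.ne
  have nbd : b ≠ d := by rintro rfl; simpa using h.bd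
  have ncd : c ≠ d := hcd.ne
  let f : V → Fin 4 := fun w => if w = b then 1 else if w = c then 2 else if w = d then 3 else 0
  have fb : f b = 1 := by simp [f]
  have fc : f c = 2 := by simp [f, nbc.symm]
  have fd : f d = 3 := by simp [f, nbd.symm, ncd.symm]
  have f0 : ∀ w, w ≠ b → w ≠ c → w ≠ d → f w = 0 := fun w h1 h2 h3 => by simp [f, h1, h2, h3]
  refine Listed.of_path_first f (fun u w huw => ?_) fun u w huw hu => ?_
  · rcases hw u with rfl | rfl | rfl | ⟨h1, h2, h3, h4, h5, h6⟩ <;>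
    rcases hw w with rfl | rfl | rfl | ⟨h1', h2', h3', h4', h5', h6'⟩
    all_goals first
      | exact (huw rfl).elim
      | simp [fb, fc, fd, hbc, hbd, hcd, hbc.symm, mt G.adj_symm hbd, hcd.symm]; done
      | simp [fb, fc, fd, f0 w h1' h2' h3', h4'.symm, mt G.adj_symm h5', mt G.adj_symm h6']
        done
      | simp [fb, fc, fd, f0 u h1 h2 h3, h4, h5, h6]; done
      | simp [f0 w h1' h2' h3', f0 u h1 h2 h3, hpair u w huw h1 h2 h3 h1' h2' h3']
  · rcases hw u with rfl | rfl | rfl | ⟨h1, h2, h3, -⟩ <;>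
    rcases hw w with rfl | rfl | rfl | ⟨h1', h2', h3', -⟩
    all_goals first
      | rfl
      | exact (hu (f0 u h1 h2 h3)).elim
      | simp [fb, fc, fd] at huw; done
      | simp [fb, fc, fd, f0 w h1' h2' h3'] at huw

namespace IsDistRealization

variable {K : Type*} [Field K] [CharZero K] {M : V → V → K}

omit [CharZero K] in
lemma eq_natCast (h : IsDistRealization G M) {u v : V} {n : ℕ} (hn : G.dist u v = n + 1) :
    M u v = n + 1 := by
  have hne : u ≠ v := by
    rintro rfl
    simp at hn
  rw [h.eq_dist hne, hn]
  push_cast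
  rfl

omit [CharZero K] in
lemma geodesic (h : IsDistRealization G M) {a b c d : V} (hP : IsGeodesicFour G a b c d) :
    M a b = 1 ∧ M b c = 1 ∧ M c d = 1 ∧ M a c = 2 ∧ M b d = 2 ∧ M a d = 3 := by
  obtain ⟨h1, h2, h3, h4, h5, h6⟩ := hP
  refine ⟨?_, ?_, ?_, ?_, ?_, ?_⟩
  · simpa using h.eq_natCast h1
  · simpa using h.eq_natCast h2
  · simpa using h.eq_natCast h3
  · rw [h.eq_natCast h4]
    norm_num
  · rw [h.eq_natCast h5]
    norm_num
  · rw [h.eq_natCast h6]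
    norm_num

/-- On a geodesic `a, b, c, d, e` three minors force the labels of `b, c, d` to be 1, 0, 1, but then
the principal minor on `b, c, d` is 2. -/
lemma dist_ne_four (h : IsDistRealization G M) (hG : G.Connected) (a e : V) :
    G.dist a e ≠ 4 := by
  intro h4
  obtain ⟨b, hab, hbe⟩ := exists_adj_dist_eq hG h4
  obtain ⟨c, d, hP⟩ := exists_isGeodesicFour hG hbe
  rw [← SimpleGraph.dist_eq_one_iff_adj] at hab
  have hbc := hP.bc
  obtain ⟨g1, g2, g3, g4, g5, g6⟩ := h.geodesic hP
  have hac : G.dist a c = 2 := by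
    have h1 := hG.dist_triangle (u := a) (v := b) (w := c)
    have h2 := hG.dist_triangle (u := a) (v := c) (w := e)
    have := hP.ab
    have := hP.bd
    omega
  have had : G.dist a d = 3 := by
    have h1 := hG.dist_triangle (u := a) (v := b) (w := d)
    have h2 := hG.dist_triangle (u := a) (v := d) (w := e)
    have := hP.ac
    have := hP.cd
    omega
  have m1 : M a b = 1 := by simpa using h.eq_natCast hab
  have m2 : M a c = 2 := by rw [h.eq_natCast hac]; norm_num
  have m3 : M a d = 3 := by rw [h.eq_natCast had]; norm_num
  have m4 : M a e = 4 := by rw [h.eq_natCast h4]; norm_num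
  have r1 := h.rank a b c c d e
  have r2 := h.rank a b c b d e
  have r3 := h.rank c d e a b d
  have r4 := h.rank b c d b c d
  simp only [h.symm c a, h.symm d a, h.symm e a, h.symm c b, h.symm d b, h.symm e b,
    h.symm d c, h.symm e d, m1, m2, m3, m4, g1, g2, g3, g4, g5, g6] at r1 r2 r3 r4
  have hc : M c c = 0 := by linear_combination r1
  have hb : M b b = 1 := by linear_combination -r2 / 2
  have hd : M d d = 1 := by linear_combination -r3 / 2
  rw [hb, hc, hd] at r4
  norm_num at r4

lemma dist_le_three (h : IsDistRealization G M) (hG : G.Connected) (u v : V) :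
    G.dist u v ≤ 3 := by
  by_contra! hlt
  obtain ⟨w, hw⟩ := exists_dist_eq (v := v) hG (Nat.succ_le_of_lt hlt) u rfl
  exact h.dist_ne_four hG w v hw

omit [CharZero K] in
-- The relation is symmetric under reversal of the geodesic. It pairs the label 1 with 0 and the
-- label 4/5 with -1.
lemma centre_relation (h : IsDistRealization G M) {a b c d : V} (hP : IsGeodesicFour G a b c d) :
    3 * M b b * M c c - 2 * M b b - 2 * M c c + 2 = 0 := by
  obtain ⟨g1, g2, g3, g4, g5, g6⟩ := h.geodesic hP
  have r := h.rank b c a b c d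
  rw [h.symm c b, g1, g2, g3, g4, g5, g6] at r
  linear_combination r

/-- Here `p, x, y, q` are the distances from a further vertex to `a, b, c, d` and `β` is the label
of `b`. The triangle inequalities leave finitely many quadruples, and for each the two equations,
linear in `β`, are checked. -/
lemma distances_of_values {p x y q : ℕ} {β : K} (hp : 1 ≤ p) (hx : 1 ≤ x) (hy : 1 ≤ y)
    (hq : 1 ≤ q) (hp' : p ≤ 3) (hx' : x ≤ 3) (hy' : y ≤ 3) (hq' : q ≤ 3)
    (hpx : p ≤ x + 1) (hxp : x ≤ p + 1) (hxy : x ≤ y + 1) (hyx : y ≤ x + 1) (hyq : y ≤ q + 1)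
    (hqy : q ≤ y + 1) (hpq : 3 ≤ p + q) (h2 : β ≠ 2) (h3 : 2 * β ≠ 1)
    (e1 : (x + q - 2 * y + β * (3 * y - 2 * q) : K) = 0)
    (e2 : (2 * p - 3 * x - q + β * (2 * q - p) : K) = 0) :
    (β = 1 ∧ p = 1 ∧ x = 1 ∧ y = 1 ∧ q = 2) ∨ (β = 4 / 5 ∧ p = 1 ∧ x = 1 ∧ y = 2 ∧ q = 3) ∨
      β = 0 ∨ β = -1 := by
  interval_cases p <;> interval_cases x <;> first | omega | skip
  all_goals interval_cases y <;> first | omega | skip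
  all_goals interval_cases q <;> first | omega | skip
  all_goals
    push_cast at e1 e2
    grind

lemma dist_geodesic_cases (h : IsDistRealization G M) (hG : G.Connected) {a b c d w : V}
    (hP : IsGeodesicFour G a b c d) (ha : w ≠ a) (hb : w ≠ b) (hc : w ≠ c) (hd : w ≠ d) :
    (M b b = 1 ∧ G.dist w a = 1 ∧ G.dist w b = 1 ∧ G.dist w c = 1 ∧ G.dist w d = 2) ∨
    (M b b = 4 / 5 ∧ G.dist w a = 1 ∧ G.dist w b = 1 ∧ G.dist w c = 2 ∧ G.dist w d = 3) ∨
      M b b = 0 ∨ M b b = -1 := by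
  obtain ⟨g1, g2, g3, g4, g5, g6⟩ := h.geodesic hP
  -- The minors `e1` and `e2` meet the diagonal only at `b`, so they involve no other unknown label;
  -- `e3` and `e4` serve to exclude the values 2 and 1/2.
  have e1 := h.rank a b w c d b
  have e2 := h.rank b c w a d b
  have e3 := h.rank a b c a b d
  have e4 := h.rank b d a b d c
  rw [g4, g2, h.eq_dist hd, h.eq_dist hb, g5, h.eq_dist hc, g6, g1] at e1
  rw [h.symm b a, h.symm c a, h.symm c b, g1, g3, h.eq_dist hd, h.eq_dist hb, g4, g2, g5,
    h.eq_dist ha] at e2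
  rw [h.symm c a, h.symm c b, h.symm b a, g4, g1, g3, g2, g5, g6] at e3
  rw [h.symm d b, h.symm d c, g5, g2, g3, g6, g1, g4] at e4
  have := hP.ab
  have := hP.bc
  have := hP.cd
  have := hP.ad
  have := G.dist_comm (u := w) (v := a)
  have := G.dist_comm (u := w) (v := b)
  have := G.dist_comm (u := w) (v := c)
  have := G.dist_comm (u := a) (v := b)
  have := G.dist_comm (u := b) (v := c)
  have := G.dist_comm (u := c) (v := d)
  have := hG.dist_triangle (u := w) (v := a) (w := b)
  have := hG.dist_triangle (u := w) (v := b) (w := a)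
  have := hG.dist_triangle (u := w) (v := b) (w := c)
  have := hG.dist_triangle (u := w) (v := c) (w := b)
  have := hG.dist_triangle (u := w) (v := c) (w := d)
  have := hG.dist_triangle (u := w) (v := d) (w := c)
  have := hG.dist_triangle (u := a) (v := w) (w := d)
  refine distances_of_values (hG.pos_dist_of_ne ha) (hG.pos_dist_of_ne hb)
    (hG.pos_dist_of_ne hc) (hG.pos_dist_of_ne hd) (h.dist_le_three hG _ _)
    (h.dist_le_three hG _ _) (h.dist_le_three hG _ _) (h.dist_le_three hG _ _)
    (by omega) (by omega) (by omega) (by omega) (by omega) (by omega) (by omega) ?_ ?_ ?_ ?_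
  · intro hb2
    rw [hb2] at e3
    have : (6 : K) = 0 := by linear_combination -e3
    norm_num at this
  · intro hb2
    have : (3 : K) = 0 := by linear_combination (2 * M d d - 3) * hb2 - 2 * e4
    norm_num at this
  · linear_combination e1
  · linear_combination e2

lemma listed_of_diag_eq_one [Fintype V] (h : IsDistRealization G M) (hG : G.Connected)
    {a b c d : V} (hP : IsGeodesicFour G a b c d) (hb1 : M b b = 1) : Listed G := by
  obtain ⟨g1, g2, g3, g4, g5, g6⟩ := h.geodesic hP
  have hc0 := centre_relation h hP
  rw [hb1] at hc0
  have hc0 : M c c = 0 := by linear_combination hc0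
  have hw : ∀ w, w ≠ a → w ≠ c → w ≠ d → M w b = 1 ∧ M w c = 1 ∧
      G.Adj w a ∧ G.Adj w c ∧ ¬ G.Adj w d := by
    intro w ha hc hd
    by_cases hb : w = b
    · subst hb
      refine ⟨hb1, g2, ?_, ?_, ?_⟩
      · exact (SimpleGraph.dist_eq_one_iff_adj.1 hP.ab).symm
      · exact SimpleGraph.dist_eq_one_iff_adj.1 hP.bc
      · simp [← SimpleGraph.dist_eq_one_iff_adj, hP.bd]
    · rcases h.dist_geodesic_cases hG hP ha hb hc hd with ⟨-, h1, h2, h3, h4⟩ | ⟨h1, -⟩ | h1 | h1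
      · refine ⟨?_, ?_, ?_, ?_, ?_⟩
        · simp [h.eq_dist hb, h2]
        · simp [h.eq_dist hc, h3]
        · exact SimpleGraph.dist_eq_one_iff_adj.1 h1
        · exact SimpleGraph.dist_eq_one_iff_adj.1 h3
        · simp [← SimpleGraph.dist_eq_one_iff_adj, h4]
      all_goals
        rw [hb1] at h1
        norm_num at h1
  refine listed_of_blowup_path_second hP (fun w => ?_) fun u w huw h1 h2 h3 h4 h5 h6 => ?_
  · have := hw w
    tauto
  · obtain ⟨k1, k2, -⟩ := hw u h1 h2 h3
    obtain ⟨k3, k4, -⟩ := hw w h4 h5 h6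
    -- Bordering the principal minor on `b, c`, here -1, by `u, w` gives distance 1, so these
    -- vertices form a clique.
    have r := h.rank b c u b c w
    rw [hb1, hc0, h.symm b w, h.symm c w, h.symm c b, g2, k1, k2, k3, k4, h.eq_dist huw] at r
    have : (G.dist u w : K) = (1 : ℕ) := by
      push_cast
      linear_combination -r
    exact SimpleGraph.dist_eq_one_iff_adj.1 (Nat.cast_injective this)

lemma listed_of_diag_eq_four_fifths [Fintype V] (h : IsDistRealization G M) (hG : G.Connected)
    {a b c d : V} (hP : IsGeodesicFour G a b c d) (hb1 : M b b = 4 / 5) : Listed G := by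
  obtain ⟨g1, g2, g3, g4, g5, g6⟩ := h.geodesic hP
  have hc0 := centre_relation h hP
  rw [hb1] at hc0
  have hc0 : M c c = -1 := by linear_combination hc0 * 5 / 2
  have hw : ∀ w, w ≠ b → w ≠ c → w ≠ d → M w b = 1 ∧ M w c = 2 ∧
      G.Adj w b ∧ ¬ G.Adj w c ∧ ¬ G.Adj w d := by
    intro w hb hc hd
    by_cases ha : w = a
    · subst ha
      refine ⟨g1, g4, ?_, ?_, ?_⟩
      · exact SimpleGraph.dist_eq_one_iff_adj.1 hP.ab
      · simp [← SimpleGraph.dist_eq_one_iff_adj, hP.ac]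
      · simp [← SimpleGraph.dist_eq_one_iff_adj, hP.ad]
    · rcases h.dist_geodesic_cases hG hP ha hb hc hd with ⟨h1, -⟩ | ⟨-, h1, h2, h3, h4⟩ | h1 | h1
      · rw [hb1] at h1
        norm_num at h1
      · refine ⟨?_, ?_, ?_, ?_, ?_⟩
        · simp [h.eq_dist hb, h2]
        · simp [h.eq_dist hc, h3]
        · exact SimpleGraph.dist_eq_one_iff_adj.1 h2
        · simp [← SimpleGraph.dist_eq_one_iff_adj, h3]
        · simp [← SimpleGraph.dist_eq_one_iff_adj, h4]
      all_goals
        rw [hb1] at h1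
        norm_num at h1
  refine listed_of_blowup_path_first hP (fun w => ?_) fun u w huw h1 h2 h3 h4 h5 h6 => ?_
  · have := hw w
    tauto
  · obtain ⟨k1, k2, -⟩ := hw u h1 h2 h3
    obtain ⟨k3, k4, -⟩ := hw w h4 h5 h6
    have r := h.rank b c u b c w
    rw [hb1, hc0, h.symm b w, h.symm c w, h.symm c b, g2, k1, k2, k3, k4, h.eq_dist huw] at r
    have : (G.dist u w : K) = (1 : ℕ) := by
      push_cast
      linear_combination -5 / 9 * r
    exact SimpleGraph.dist_eq_one_iff_adj.1 (Nat.cast_injective this)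

lemma listed_of_geodesic [Fintype V] (h : IsDistRealization G M) (hG : G.Connected)
    {a b c d : V} (hP : IsGeodesicFour G a b c d) : Listed G := by
  by_cases h1 : M b b = 1
  · exact h.listed_of_diag_eq_one hG hP h1
  by_cases h2 : M c c = 1
  · exact h.listed_of_diag_eq_one hG hP.reverse h2
  by_cases h3 : M b b = 4 / 5
  · exact h.listed_of_diag_eq_four_fifths hG hP h3
  by_cases h4 : M c c = 4 / 5
  · exact h.listed_of_diag_eq_four_fifths hG hP.reverse h4
  -- A further vertex would give `M b b` the value 0 or -1, hence `M c c` the value 1 or 4/5 by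
  -- `centre_relation`. So the graph is the path itself.
  have hw : ∀ w, w ≠ a → w ≠ c → w ≠ d → w = b := by
    intro w ha hc hd
    by_contra hb
    have hr := centre_relation h hP
    rcases h.dist_geodesic_cases hG hP ha hb hc hd with ⟨h5, -⟩ | ⟨h5, -⟩ | h5 | h5
    · exact h1 h5
    · exact h3 h5
    · rw [h5] at hr
      exact h2 (by linear_combination -hr / 2)
    · rw [h5] at hr
      exact h4 (by linear_combination -hr / 5)
  refine listed_of_blowup_path_second hP (fun w => ?_) fun u w huw h1 h2 h3 h4 h5 h6 => ?_
  · by_cases hwb : w = b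
    · subst hwb
      have hbc := SimpleGraph.dist_eq_one_iff_adj.1 hP.bc
      have hab := SimpleGraph.dist_eq_one_iff_adj.1 hP.ab
      have hbd : ¬ G.Adj w d := by simp [← SimpleGraph.dist_eq_one_iff_adj, hP.bd]
      have nbd : w ≠ d := by rintro rfl; simpa using hP.bd
      exact Or.inr (Or.inr (Or.inr ⟨hab.ne', hbc.ne, nbd, hab.symm, hbc, hbd⟩))
    · have := hw w
      tauto
  · exact (huw ((hw u h1 h2 h3).trans (hw w h4 h5 h6).symm)).elim

lemma listed [Fintype V] (h : IsDistRealization G M) (hG : G.Connected) : Listed G := by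
  by_cases h3 : ∃ a d, G.dist a d = 3
  · obtain ⟨a, d, had⟩ := h3
    obtain ⟨b, c, hP⟩ := exists_isGeodesicFour hG had
    exact h.listed_of_geodesic hG hP
  have hdist : ∀ u v, u ≠ v → ¬ G.Adj u v → G.dist u v = 2 := by
    intro u v huv hadj
    have h1 := h.dist_le_three hG u v
    have h2 := two_le_dist hG huv hadj
    have h4 : G.dist u v ≠ 3 := fun h4 => h3 ⟨u, v, h4⟩
    omega
  have hreal : IsRealization G M :=
    { rank := h.rank
      symm := h.symm
      adj := fun {u v} huv => by
        simpa using h.eq_natCast (n := 0) (SimpleGraph.dist_eq_one_iff_adj.2 huv)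
      nonadj := fun {u v} hne huv => by
        rw [h.eq_dist hne, hdist u v hne huv]
        norm_num }
  refine hreal.listed hG fun u v hne huv => ?_
  obtain ⟨w, huw, hwv⟩ := exists_adj_dist_eq hG (hdist u v hne huv)
  exact ⟨w, huw, SimpleGraph.dist_eq_one_iff_adj.1 hwv⟩

end IsDistRealization

end DistanceIdeals

theorem mainTheorem5 {V : Type*} [Fintype V] [DecidableEq V] (G : SimpleGraph V) :
    DistanceIdeals.InLambda ℚ 2 G ↔
      G.Connected ∧
        ((∃ n m : ℕ, 1 ≤ n ∧ 1 ≤ m ∧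
            Nonempty (G ≃g completeBipartiteGraph (Fin n) (Fin m))) ∨
          (∃ n m : ℕ, 1 ≤ n ∧ 1 ≤ m ∧
            Nonempty (G ≃g DistanceIdeals.multipartite ![1, n, m])) ∨
          (∃ p : ℕ, 1 ≤ p ∧ p ≤ Fintype.card V ∧
            Nonempty (G ≃g DistanceIdeals.multipartite
              (fun i : Fin p => if (i : ℕ) = 0 then Fintype.card V - (p - 1) else 1))) ∨
          (∃ n m : ℕ, G.IsIndContained (DistanceIdeals.pathBlowup ![(n : ℤ), -(m : ℤ), 0])) ∨
          (∃ n₁ n₂ : ℕ,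
            G.IsIndContained (DistanceIdeals.pathBlowup ![(n₁ : ℤ), 0, (n₂ : ℤ)])) ∨
          (∃ n : ℕ, G.IsIndContained (DistanceIdeals.pathBlowup ![0, (n : ℤ), 0, 0])) ∨
          (∃ n : ℕ, G.IsIndContained (DistanceIdeals.pathBlowup ![(n : ℤ), 0, 0, 0])) ∨
          (∃ n m : ℕ,
            G.IsIndContained (DistanceIdeals.pathBlowup ![(n : ℤ), 0, -(m : ℤ)]))) := by
  rw [DistanceIdeals.inLambda_iff]
  refine and_congr_right fun hG => ⟨fun h => ?_, ?_⟩
  · obtain ⟨K, _, _, M, hM, hsymm, hdist⟩ := DistanceIdeals.exists_rankLeTwo G h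
    exact DistanceIdeals.IsDistRealization.listed ⟨hM, hsymm, fun huv => hdist _ _ huv⟩ hG
  · rintro (⟨n, m, -, -, ⟨φ⟩⟩ | ⟨n, m, -, -, ⟨φ⟩⟩ | ⟨p, -, -, ⟨φ⟩⟩ | ⟨n, m, h⟩ | ⟨n, m, h⟩ | ⟨n, h⟩ |
      ⟨n, h⟩ | ⟨n, m, h⟩)
    · exact DistanceIdeals.distIdeal_ne_top_bipartite hG φ
    · exact DistanceIdeals.distIdeal_ne_top_tripartite hG φ
    · exact DistanceIdeals.distIdeal_ne_top_split hG φ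
    · exact DistanceIdeals.distIdeal_ne_top_clique_indep_single hG h
    · exact DistanceIdeals.distIdeal_ne_top_clique_single_clique hG h
    · exact DistanceIdeals.distIdeal_ne_top_path_second hG h
    · exact DistanceIdeals.distIdeal_ne_top_path_first hG h
    · exact DistanceIdeals.distIdeal_ne_top_clique_single_indep hG h
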